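/- Let $N\ge 2$ and $d\ge 1$ be integers, let $\Omega\subset\mathbb{R}^d$ be a nonempty bounded open convex set, let $\mu$ be Lebesgue measure on $\Omega$ normalized to be a probability, and let $u:\Omega\to\mathbb{R}^d$ be a bounded measurable vector field. Let $\sigma(x_1,\dots,x_N)=(x_2,\dots,x_N,x_1)$, and denote by - $\mathcal{P}^\mu_{\rm sym}(\Omega^N)$ the set of $\sigma$-invariant Borel probability measures on $\Omega^N$ with first marginal $\mu$; - $\mathcal{S}_N(\Omega,\mu)$ the set of $\mu$-measure preserving maps $S:\Omega\to\Omega$ with $S^N=I$ $\mu$-a.e.; - $\mathcal{H}_N(\Omega)$ the set of continuous $H:\Omega^N\to\mathbb{R}$ with $\sum_{i=0}^{N-1}H(\sigma^i(\mathbf{x}))=0$ for all $\mathbf{x}\in\Omega^N$; - $L_H(x,p_1,\dots,p_{N-1})=\sup\{\sum_{i=1}^{N-1}\langle p_i,y_i\rangle-H(x,y_1,\dots,y_{N-1}):\ y_1,\dots,y_{N-1}\in\Omega\}\in(-\infty,+\infty]$, for $H:\Omega^N\to\mathbb{R}$, $x\in\Omega$, $p_i\in\mathbb{R}^d$. Then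 the following are equivalent. 1. $u$ is $N$-cyclically monotone a.e.: there is a set $\Omega_0$ of measure zero such that $\sum_{i=1}^N\langle u(x_i),x_i-x_{i+1}\rangle\ge 0$ for all $x_1,\dots,x_N,\ x_{N+1}=x_1$ in $\Omega\setminus\Omega_0$. 2. $\inf\{\int_{\Omega^N}\langle u(x_1),x_1-x_2\rangle\,d\pi:\ \pi\in\mathcal{P}^\mu_{\rm sym}(\Omega^N)\}=0$, and this infimum is attained at the push-forward of $\mu$ by the map $x\mapsto(x,\dots,x)$. 3. $u$ is in the polar of $\mathcal{S}_N(\Omega,\mu)$: $\inf\{\int_\Omega\langle u(x),x-Sx\rangle\,d\mu:\ S\in\mathcal{S}_N(\Omega,\mu)\}=0$. 4. The identity is a projection of $u$ on $\mathcal{S}_N(\Omega,\mu)$: $\inf\{\int_\Omega|u(x)-Sx|^2\,d\mu:\ S\in\mathcal{S}_N(\Omega,\mu)\}=\int_\Omega|u(x)-x|^2\,d\mu$. 5. There is a function $H:\Omega\times\Omega\to\mathbb{R}$, concave in the first and convex in the second variable, with $H(x,x)=0$ for all $x\in\Omega$ and $\sum_{i=1}^NH(x_i,x_{i+1})\le 0$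 for all $x_1,\dots,x_N,\ x_{N+1}=x_1$ in $\Omega$, such that for a.e. $x\in\Omega$ the function $H(x,\cdot)$ is differentiable at $x$ with $u(x)=\nabla_2H(x,x)$. 6. $\inf\{\int_\Omega L_H(x,u(x),0,\dots,0)\,d\mu:\ H\in\mathcal{H}_N(\Omega)\}=\sup\{\int_\Omega\langle u(x),Sx\rangle\,d\mu:\ S\in\mathcal{S}_N(\Omega,\mu)\}$, and the supremum is attained at $S=I$. -/

import Mathlib

open MeasureTheory

namespace CyclicMonotone

noncomputable section

/-- The Euclidean space `ℝ^d`. -/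
abbrev E (d : ℕ) : Type := EuclideanSpace ℝ (Fin d)

/-- Lebesgue measure on `Ω`, normalized to a probability: `(volume Ω)⁻¹ • volume.restrict Ω`. -/
def normalizedVolume {d : ℕ} (Ω : Set (E d)) : Measure (E d) :=
  ProbabilityTheory.cond volume Ω

/-- The product set `Ω^N`. -/
def power {d : ℕ} (Ω : Set (E d)) (N : ℕ) : Set (Fin N → E d) :=
  {x | ∀ i, x i ∈ Ω}

/-- The cyclic permutation `σ (x_1, …, x_N) = (x_2, …, x_N, x_1)`
(addition in `Fin N` is modulo `N`). -/
def cyclicShift {d N : ℕ} [NeZero N] (x : Fin N → E d) : Fin N → E d :=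
  fun i => x (i + 1)

/-- `u` is `N`-cyclically monotone on `A`: `∑ ⟨u (x_i), x_i - x_{i+1}⟩ ≥ 0` for all cycles
`x_1, …, x_N, x_{N+1} = x_1` in `A`. -/
def IsCyclicallyMonotoneOn {d : ℕ} (N : ℕ) [NeZero N] (u : E d → E d) (A : Set (E d)) : Prop :=
  ∀ x : Fin N → E d, (∀ i, x i ∈ A) → 0 ≤ ∑ i, inner ℝ (u (x i)) (x i - x (i + 1))

/-- The `σ`-invariant probability measures on `Ω^N` whose first marginal is the normalized
Lebesgue measure of `Ω`. -/
def symmetricPlans {d : ℕ} (Ω : Set (E d)) (N : ℕ) [NeZero N] : Set (Measure (Fin N → E d)) :=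
  {π | IsProbabilityMeasure π ∧ (∀ᵐ x ∂π, x ∈ power Ω N) ∧
    MeasurePreserving cyclicShift π π ∧ π.map (fun x => x 0) = normalizedVolume Ω}

/-- The measure preserving transformations `S` of `Ω` with `S^N = I` almost everywhere. -/
def measurePreservingInvolutions {d : ℕ} (Ω : Set (E d)) (N : ℕ) : Set (E d → E d) :=
  {S | Set.MapsTo S Ω Ω ∧ MeasurePreserving S (normalizedVolume Ω) (normalizedVolume Ω) ∧
    ∀ᵐ x ∂(normalizedVolume Ω), S^[N] x = x}

/-- `F` is `N`-cyclically sub-antisymmetric on `Ω`: it vanishes on the diagonal and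
`∑ F (x_i, x_{i+1}) ≤ 0` for all cycles `x_1, …, x_N, x_{N+1} = x_1` in `Ω`. -/
def IsCyclicallySubAntisymmetricOn {d : ℕ} (N : ℕ) [NeZero N] (F : E d → E d → ℝ)
    (Ω : Set (E d)) : Prop :=
  (∀ x ∈ Ω, F x x = 0) ∧
    ∀ x : Fin N → E d, (∀ i, x i ∈ Ω) → ∑ i, F (x i) (x (i + 1)) ≤ 0

/-- The continuous `N`-antisymmetric Hamiltonians on `Ω^N`. -/
def antisymmetricHamiltonians {d : ℕ} (Ω : Set (E d)) (N : ℕ) [NeZero N] :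
    Set ((Fin N → E d) → ℝ) :=
  {H | ContinuousOn H (power Ω N) ∧
    ∀ x ∈ power Ω N, ∑ i ∈ Finset.range N, H (cyclicShift^[i] x) = 0}

/-- `L_H (x, p_1, …, p_m) = sup {∑ ⟨p_i, y_i⟩ - H (x, y_1, …, y_m) ; y_i ∈ Ω}`, for a function
`H` of `m + 1` variables. The supremum may be `+∞`. -/
def legendre {d m : ℕ} (Ω : Set (E d)) (H : (Fin (m + 1) → E d) → ℝ) (x : E d)
    (p : Fin m → E d) : EReal :=
  ⨆ y ∈ power Ω m, (((∑ i, inner ℝ (p i) (y i)) - H (Fin.cons x y) : ℝ) : EReal)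

/-- The integral of an extended real function, `∫ f⁺ - ∫ f⁻`. -/
def extIntegral {d : ℕ} (μ : Measure (E d)) (f : E d → EReal) : EReal :=
  ((∫⁻ x, (f x).toENNReal ∂μ : ENNReal) : EReal) - ((∫⁻ x, (-f x).toENNReal ∂μ : ENNReal) : EReal)

end

end CyclicMonotone

/-! Cyclic monotonicity is a condition on points, membership in the polar a condition on maps, and
symmetric plans link the two. The cost of a `σ`-invariant plan equals the average of the cyclic
sums, so it is nonnegative when `u` is cyclically monotone. The orbit map `x ↦ (x, S x, …, S^(N-1)
x)` turns each `S` with `S^N = I` into such a plan. To return from maps to points, test the polar on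
maps that permute small disjoint balls near `x_1, …, x_N` cyclically by translation, and let the
radius shrink: Lebesgue differentiation recovers the pointwise inequality
(`exists_isCyclicallyMonotoneOn_of_polar`). The projection property is the polar condition after
expanding the square.

For the Hamiltonian, take the concave envelope in `x` of `⟨u x, y - x⟩`, realized as a supremum over
the convex hull of the points `(a, u a, ⟨u a, a⟩)`. The cyclic sum is affine in each vertex
separately, so its sign passes from the graph to the hull, and the envelope `F` is cyclically
sub-antisymmetric. The bounds `⟨u x, y - x⟩ ≤ F x y ≤ ⟨u y, y - x⟩`, with the a.e. continuity of a
monotone field (`ae_continuousWithinAt_of_monotone`), give `∇₂F(x, x) = u x`. Conversely,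
subgradient inequalities summed around a cycle give cyclic monotonicity.

For the duality formula, every antisymmetric `H` vanishes on the diagonal, so `L_H(x, u x, 0, …, 0)
≥ ⟨u x, x⟩`; the antisymmetrization of `F` attains equality almost everywhere
(`iInf_extIntegral_legendre`). -/

namespace CyclicMonotone

/-! ### Cyclic sums and their multi-affine structure -/

section Cycles

/-- The sum over a cycle `x, y, y, …, y` of a function vanishing on the diagonal reduces to two
terms. -/
lemma sum_cycle_two_points {d n : ℕ} (Φ : E d → E d → ℝ) (x y : E d) (hy : Φ y y = 0) :
    ∑ i : Fin (n + 2), Φ (if i = 0 then x else y) (if i + 1 = 0 then x else y) =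
      Φ x y + Φ y x := by
  rw [Fin.sum_univ_succ, Fin.sum_univ_castSucc]
  have hmid : ∀ j : Fin n, j.castSucc.succ + 1 ≠ (0 : Fin (n + 2)) := by
    intro j h
    have : j.castSucc.succ + 1 = j.succ.succ := by
      rw [Fin.succ_castSucc, Fin.coeSucc_eq_succ]
    rw [this] at h
    exact Fin.succ_ne_zero _ h
  have hlast : (Fin.last n).succ + 1 = (0 : Fin (n + 2)) := by
    rw [Fin.succ_last, Fin.last_add_one]
  have h01 : (1 : Fin (n + 2)) ≠ 0 := one_ne_zero
  simp only [hmid, hlast, h01, Fin.succ_ne_zero, if_true, if_false, hy, Finset.sum_const_zero,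
    zero_add]

lemma sum_shift {M : Type*} [AddCommMonoid M] {N : ℕ} [NeZero N] (f : Fin N → M) :
    ∑ i, f (i + 1) = ∑ i, f i :=
  Equiv.sum_comp (Equiv.addRight (1 : Fin N)) f

/-- The cyclic sum of a function that is affine in each point of the cycle is nonpositive on the
convex hull of a set as soon as it is on the set. -/
lemma cyclic_sum_nonpos_of_mem_convexHull {d n : ℕ} {G : Set (E d × E d × ℝ)}
    (hG : ∀ s : Fin (n + 2) → E d × E d × ℝ, (∀ i, s i ∈ G) →
      ∑ i, (inner ℝ (s i).2.1 (s (i + 1)).1 - (s i).2.2) ≤ 0)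
    (s : Fin (n + 2) → E d × E d × ℝ) (hs : ∀ i, s i ∈ convexHull ℝ G) :
    ∑ i, (inner ℝ (s i).2.1 (s (i + 1)).1 - (s i).2.2) ≤ 0 := by
  -- The vertices are moved from `G` to its convex hull one at a time; `T` is the set of those
  -- already moved.
  suffices H : ∀ (T : Finset (Fin (n + 2))) (s : Fin (n + 2) → E d × E d × ℝ),
      (∀ i ∈ T, s i ∈ convexHull ℝ G) → (∀ i ∉ T, s i ∈ G) →
      ∑ i, (inner ℝ (s i).2.1 (s (i + 1)).1 - (s i).2.2) ≤ 0 from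
    H Finset.univ s (fun i _ => hs i) (fun i hi => absurd (Finset.mem_univ i) hi)
  intro T
  induction T using Finset.induction_on with
  | empty => exact fun s _ h => hG s fun i => h i (Finset.notMem_empty i)
  | insert k T hk ih =>
    intro s hsT hsG
    set Φ : E d × E d × ℝ → ℝ := fun z =>
      ∑ i, (inner ℝ (Function.update s k z i).2.1 (Function.update s k z (i + 1)).1 -
        (Function.update s k z i).2.2) with hΦ
    have haff : ∀ z w : E d × E d × ℝ, ∀ a b : ℝ, a + b = 1 →
        Φ (a • z + b • w) = a * Φ z + b * Φ w := by
      intro z w a b hab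
      simp only [hΦ, Finset.mul_sum, ← Finset.sum_add_distrib]
      refine Finset.sum_congr rfl fun i _ => ?_
      have hb : b = 1 - a := by linarith
      by_cases h1 : i = k
      · have h2 : i + 1 ≠ k := by
          rw [h1]; simp
        subst h1
        simp only [Function.update_self, Function.update_of_ne h2, Prod.snd_add, Prod.fst_add,
          Prod.smul_snd, Prod.smul_fst, inner_add_left, real_inner_smul_left, smul_eq_mul]
        ring
      · by_cases h2 : i + 1 = k
        · subst h2
          simp only [Function.update_self, Function.update_of_ne h1, Prod.fst_add,
            Prod.smul_fst, inner_add_right, real_inner_smul_right]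
          rw [hb]; ring
        · simp only [Function.update_of_ne h1, Function.update_of_ne h2]
          rw [hb]; ring
    have hconv : Convex ℝ {z | Φ z ≤ 0} := by
      intro z hz w hw a b ha hb hab
      simp only [Set.mem_ofPred_eq] at hz hw ⊢
      rw [haff z w a b hab]
      nlinarith [mul_nonneg ha (neg_nonneg.2 hz), mul_nonneg hb (neg_nonneg.2 hw)]
    have hsub : G ⊆ {z | Φ z ≤ 0} := by
      intro z hz
      refine ih (Function.update s k z) (fun i hi => ?_) fun i hi => ?_
      · have : i ≠ k := fun h => hk (h ▸ hi)
        rw [Function.update_of_ne this]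
        exact hsT i (Finset.mem_insert_of_mem hi)
      · by_cases h : i = k
        · subst h; simpa using hz
        · rw [Function.update_of_ne h]
          exact hsG i (by simp [h, hi])
    have := convexHull_min hsub hconv (hsT k (Finset.mem_insert_self k T))
    simpa [hΦ] using this

end Cycles

/-! ### The concave-convex envelope of a cyclically monotone field -/

section Saddle

/-- The convex hull of the points `(a, u a, ⟨u a, a⟩)`, `a ∈ A`: each point `(x, q, c)` of it
encodes the affine function `y ↦ ⟨q, y⟩ - c` attached to the barycenter `x`. -/
def graphHull {d : ℕ} (u : E d → E d) (A : Set (E d)) : Set (E d × E d × ℝ) :=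
  convexHull ℝ ((fun a => (a, u a, inner ℝ (u a) a)) '' A)

/-- The values at `y` of the affine functions attached to `x`. -/
def saddleValues {d : ℕ} (u : E d → E d) (A : Set (E d)) (x y : E d) : Set ℝ :=
  (fun s : E d × ℝ => inner ℝ s.1 y - s.2) '' {s | (x, s) ∈ graphHull u A}

/-- The concave envelope in `x` of `⟨u x, y - x⟩`. -/
noncomputable def saddle {d : ℕ} (u : E d → E d) (A : Set (E d)) (x y : E d) : ℝ :=
  sSup (saddleValues u A x y)

variable {d n : ℕ} {u : E d → E d} {A Ω : Set (E d)} {C R : ℝ}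

lemma mem_graphHull {a : E d} (ha : a ∈ A) : (a, u a, inner ℝ (u a) a) ∈ graphHull u A :=
  subset_convexHull ℝ _ ⟨a, ha, rfl⟩

lemma isLinearMap_affineValue (y : E d) :
    IsLinearMap ℝ (fun p : E d × E d × ℝ => inner ℝ p.2.1 y - p.2.2) :=
  ⟨fun p q => by simp only [Prod.snd_add, Prod.fst_add, inner_add_left]; ring,
   fun c p => by
    simp only [Prod.smul_snd, Prod.smul_fst, real_inner_smul_left, smul_eq_mul]; ring⟩

lemma norm_le_of_mem_graphHull (hC : ∀ a ∈ A, ‖u a‖ ≤ C) {p : E d × E d × ℝ}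
    (hp : p ∈ graphHull u A) : ‖p.2.1‖ ≤ C := by
  have hlin : IsLinearMap ℝ (fun p : E d × E d × ℝ => p.2.1) := ⟨fun _ _ => rfl, fun _ _ => rfl⟩
  have hconv : Convex ℝ {p : E d × E d × ℝ | p.2.1 ∈ Metric.closedBall (0 : E d) C} :=
    (convex_closedBall 0 C).is_linear_preimage hlin
  have := convexHull_min (s := (fun a => (a, u a, inner ℝ (u a) a)) '' A) (by
    rintro _ ⟨a, ha, rfl⟩
    simpa using hC a ha) hconv hp
  simpa using this

/-- A real `sSup` is `0` on unbounded or empty sets, so this bound and the nonemptiness below are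
what make `saddle` a genuine supremum. -/
lemma bddAbove_saddleValues (hC : ∀ a ∈ A, ‖u a‖ ≤ C) (hR : ∀ a ∈ A, ‖a‖ ≤ R) (x y : E d) :
    BddAbove (saddleValues u A x y) := by
  refine ⟨C * (‖y‖ + R), ?_⟩
  rintro _ ⟨s, hs, rfl⟩
  refine convexHull_min (s := (fun a => (a, u a, inner ℝ (u a) a)) '' A) ?_
    (convex_halfSpace_le (isLinearMap_affineValue y) (C * (‖y‖ + R))) hs
  rintro _ ⟨a, ha, rfl⟩
  simp only [Set.mem_ofPred_eq]
  rw [← inner_sub_right]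
  have h0 : 0 ≤ C := (norm_nonneg _).trans (hC a ha)
  calc inner ℝ (u a) (y - a) ≤ ‖u a‖ * ‖y - a‖ := real_inner_le_norm _ _
    _ ≤ C * (‖y‖ + R) := mul_le_mul (hC a ha)
        ((norm_sub_le _ _).trans (by linarith [hR a ha])) (norm_nonneg _) h0

lemma le_saddle (hC : ∀ a ∈ A, ‖u a‖ ≤ C) (hR : ∀ a ∈ A, ‖a‖ ≤ R) {x : E d} {s : E d × ℝ}
    (hs : (x, s) ∈ graphHull u A) (y : E d) : inner ℝ s.1 y - s.2 ≤ saddle u A x y :=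
  le_csSup (bddAbove_saddleValues hC hR x y) ⟨s, hs, rfl⟩

lemma inner_le_saddle (hC : ∀ a ∈ A, ‖u a‖ ≤ C) (hR : ∀ a ∈ A, ‖a‖ ≤ R) {x : E d} (hx : x ∈ A)
    (y : E d) : inner ℝ (u x) (y - x) ≤ saddle u A x y := by
  rw [inner_sub_right]
  exact le_saddle hC hR (mem_graphHull hx) y

/-- A point outside `A` still has hull elements above it: average the graph points at `x ± v`. Each
contributes an affine function whose value at `x` is at least `-C‖v‖`. -/
lemma exists_mem_graphHull (hC : ∀ a ∈ A, ‖u a‖ ≤ C) {x v : E d} (h1 : x + v ∈ A)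
    (h2 : x - v ∈ A) :
    ∃ s : E d × ℝ, (x, s) ∈ graphHull u A ∧ -(C * ‖v‖) ≤ inner ℝ s.1 x - s.2 := by
  refine ⟨(1 / 2 : ℝ) • (u (x + v), inner ℝ (u (x + v)) (x + v)) +
    (1 / 2 : ℝ) • (u (x - v), inner ℝ (u (x - v)) (x - v)), ?_, ?_⟩
  · have := (convex_convexHull ℝ ((fun a => (a, u a, inner ℝ (u a) a)) '' A))
      (mem_graphHull (u := u) h1) (mem_graphHull (u := u) h2) (a := 1 / 2) (b := 1 / 2)
      (by norm_num) (by norm_num) (by norm_num)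
    have hx : x = (1 / 2 : ℝ) • (x + v) + (1 / 2 : ℝ) • (x - v) := by module
    rw [graphHull]
    nth_rewrite 1 [hx]
    exact this
  · have e1 := (abs_le.1 (abs_real_inner_le_norm (u (x + v)) v)).2
    have e2 := (abs_le.1 (abs_real_inner_le_norm (u (x - v)) v)).1
    have e3 := mul_le_mul_of_nonneg_right (hC _ h1) (norm_nonneg v)
    have e4 := mul_le_mul_of_nonneg_right (hC _ h2) (norm_nonneg v)
    simp only [Prod.fst_add, Prod.smul_fst, Prod.snd_add, Prod.smul_snd, inner_add_left,
      real_inner_smul_left, inner_add_right, inner_sub_right, smul_eq_mul]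
    linarith

lemma saddleValues_nonempty (hC : ∀ a ∈ A, ‖u a‖ ≤ C) {x v : E d} (h1 : x + v ∈ A)
    (h2 : x - v ∈ A) (y : E d) : (saddleValues u A x y).Nonempty :=
  let ⟨s, hs, _⟩ := exists_mem_graphHull hC h1 h2
  ⟨_, s, hs, rfl⟩

/-- Every point of `Ω` is the midpoint of points of `A` arbitrarily close to it. -/
def MidpointDense (A Ω : Set (E d)) : Prop :=
  ∀ x ∈ Ω, ∀ ε > 0, ∃ v : E d, ‖v‖ < ε ∧ x + v ∈ A ∧ x - v ∈ A

lemma MidpointDense.saddleValues_nonempty (hmid : MidpointDense A Ω)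
    (hC : ∀ a ∈ A, ‖u a‖ ≤ C) {x : E d} (hx : x ∈ Ω) (y : E d) :
    (saddleValues u A x y).Nonempty :=
  let ⟨_, _, h1, h2⟩ := hmid x hx 1 one_pos
  CyclicMonotone.saddleValues_nonempty hC h1 h2 y

lemma sum_saddle_nonpos (hcyc : IsCyclicallyMonotoneOn (n + 2) u A) (hmid : MidpointDense A Ω)
    (hC : ∀ a ∈ A, ‖u a‖ ≤ C) (x : Fin (n + 2) → E d)
    (hx : ∀ i, x i ∈ Ω) : ∑ i, saddle u A (x i) (x (i + 1)) ≤ 0 := by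
  have hG : ∀ s : Fin (n + 2) → E d × E d × ℝ,
      (∀ i, s i ∈ (fun a => (a, u a, inner ℝ (u a) a)) '' A) →
      ∑ i, (inner ℝ (s i).2.1 (s (i + 1)).1 - (s i).2.2) ≤ 0 := by
    intro s hs
    choose a ha hsa using hs
    have := hcyc a ha
    simp only [← hsa]
    have e : ∑ i, (inner ℝ (u (a i)) (a (i + 1)) - inner ℝ (u (a i)) (a i)) =
        - ∑ i, inner ℝ (u (a i)) (a i - a (i + 1)) := by
      rw [← Finset.sum_neg_distrib]
      exact Finset.sum_congr rfl fun i _ => by rw [inner_sub_right]; ring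
    rw [e]
    linarith
  refine le_of_forall_pos_le_add fun ε hε => ?_
  -- Nearly optimal hull elements are chosen at each vertex, the error `ε` being shared among the `n
  -- + 2` of them.
  have hε' : 0 < ε / (n + 2 : ℝ) := by positivity
  have hex : ∀ i, ∃ s : E d × ℝ, (x i, s) ∈ graphHull u A ∧
      saddle u A (x i) (x (i + 1)) < inner ℝ s.1 (x (i + 1)) - s.2 + ε / (n + 2 : ℝ) := by
    intro i
    obtain ⟨_, ⟨s, hs, rfl⟩, h⟩ := exists_lt_of_lt_csSup
      (hmid.saddleValues_nonempty (u := u) hC (hx i) (x (i + 1)))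
      (sub_lt_self (saddle u A (x i) (x (i + 1))) hε')
    exact ⟨s, hs, by linarith⟩
  choose s hs hlt using hex
  have h1 := cyclic_sum_nonpos_of_mem_convexHull hG (fun i => (x i, s i)) hs
  calc ∑ i, saddle u A (x i) (x (i + 1))
      ≤ ∑ i, (inner ℝ (s i).1 (x (i + 1)) - (s i).2 + ε / (n + 2 : ℝ)) :=
        Finset.sum_le_sum fun i _ => (hlt i).le
    _ = ∑ i, (inner ℝ (s i).1 (x (i + 1)) - (s i).2) + ε := by
        rw [Finset.sum_add_distrib]
        simp only [Finset.sum_const, Finset.card_univ, Fintype.card_fin, nsmul_eq_mul]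
        push_cast
        field_simp
    _ ≤ 0 + ε := by gcongr

lemma saddle_self (hcyc : IsCyclicallyMonotoneOn (n + 2) u A) (hmid : MidpointDense A Ω)
    (hC : ∀ a ∈ A, ‖u a‖ ≤ C) (hR : ∀ a ∈ A, ‖a‖ ≤ R) {x : E d} (hx : x ∈ Ω) :
    saddle u A x x = 0 := by
  apply le_antisymm
  -- Upper bound from the constant cycle; the lower bound comes from midpoints `x ± v` with `v → 0`.
  · have := sum_saddle_nonpos hcyc hmid hC (fun _ => x) fun _ => hx
    simp only [Finset.sum_const, Finset.card_univ, Fintype.card_fin, nsmul_eq_mul] at this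
    exact nonpos_of_mul_nonpos_right this (by positivity)
  · have hC0 : 0 ≤ C := by
      obtain ⟨v, -, h1, -⟩ := hmid x hx 1 one_pos
      exact (norm_nonneg _).trans (hC _ h1)
    refine le_of_forall_pos_le_add fun ε hε => ?_
    obtain ⟨v, hv, h1, h2⟩ := hmid x hx (ε / (C + 1)) (by positivity)
    obtain ⟨s, hs, h⟩ := exists_mem_graphHull (u := u) hC h1 h2
    have h3 := le_saddle hC hR hs x
    rw [lt_div_iff₀ (by positivity)] at hv
    nlinarith [norm_nonneg v]

lemma isCyclicallySubAntisymmetricOn_saddle (hcyc : IsCyclicallyMonotoneOn (n + 2) u A)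
    (hmid : MidpointDense A Ω) (hC : ∀ a ∈ A, ‖u a‖ ≤ C) (hR : ∀ a ∈ A, ‖a‖ ≤ R) :
    IsCyclicallySubAntisymmetricOn (n + 2) (saddle u A) Ω :=
  ⟨fun _ hx => saddle_self hcyc hmid hC hR hx, sum_saddle_nonpos hcyc hmid hC⟩

lemma saddle_add_saddle_nonpos (hcyc : IsCyclicallyMonotoneOn (n + 2) u A)
    (hmid : MidpointDense A Ω) (hC : ∀ a ∈ A, ‖u a‖ ≤ C) (hR : ∀ a ∈ A, ‖a‖ ≤ R) {x y : E d}
    (hx : x ∈ Ω) (hy : y ∈ Ω) : saddle u A x y + saddle u A y x ≤ 0 := by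
  rw [← sum_cycle_two_points (n := n) (saddle u A) x y (saddle_self hcyc hmid hC hR hy)]
  refine sum_saddle_nonpos hcyc hmid hC (fun i => if i = 0 then x else y) fun i => ?_
  split_ifs
  exacts [hx, hy]

/-- Two-point antisymmetry bounds `F x y` by `-F y x`, and `F y x ≥ ⟨u y, x - y⟩` because `y ∈ A`.
-/
lemma saddle_le_inner (hcyc : IsCyclicallyMonotoneOn (n + 2) u A) (hmid : MidpointDense A Ω)
    (hC : ∀ a ∈ A, ‖u a‖ ≤ C) (hR : ∀ a ∈ A, ‖a‖ ≤ R) (hAΩ : A ⊆ Ω) {x y : E d} (hx : x ∈ Ω)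
    (hy : y ∈ A) : saddle u A x y ≤ inner ℝ (u y) (y - x) := by
  have h1 := saddle_add_saddle_nonpos hcyc hmid hC hR hx (hAΩ hy)
  have h2 := inner_le_saddle hC hR hy x
  rw [← neg_sub y x, inner_neg_right] at h2
  linarith

/-- Cyclic monotonicity implies monotonicity. -/
lemma IsCyclicallyMonotoneOn.monotone (hcyc : IsCyclicallyMonotoneOn (n + 2) u A) {x y : E d}
    (hx : x ∈ A) (hy : y ∈ A) : 0 ≤ inner ℝ (u x - u y) (x - y) := by
  have h := hcyc (fun i => if i = 0 then x else y) fun i => by split_ifs; exacts [hx, hy]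
  have := sum_cycle_two_points (n := n) (fun a b => inner ℝ (u a) (a - b)) x y (by simp)
  rw [this] at h
  rw [inner_sub_left]
  rw [← neg_sub x y, inner_neg_right] at h
  linarith

/-- The hull is convex, so combining nearly optimal data above `x` and `z` gives admissible data
above their barycenter. -/
lemma concaveOn_saddle (hmid : MidpointDense A Ω) (hC : ∀ a ∈ A, ‖u a‖ ≤ C)
    (hR : ∀ a ∈ A, ‖a‖ ≤ R) (hΩ : Convex ℝ Ω) (y : E d) :
    ConcaveOn ℝ Ω (fun x => saddle u A x y) := by
  refine ⟨hΩ, fun x hx z hz a b ha hb hab => ?_⟩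
  refine le_of_forall_pos_le_add fun ε hε => ?_
  obtain ⟨_, ⟨s, hs, rfl⟩, h1⟩ := exists_lt_of_lt_csSup
    (hmid.saddleValues_nonempty (u := u) hC hx y) (sub_lt_self (saddle u A x y) hε)
  obtain ⟨_, ⟨t, ht, rfl⟩, h2⟩ := exists_lt_of_lt_csSup
    (hmid.saddleValues_nonempty (u := u) hC hz y) (sub_lt_self (saddle u A z y) hε)
  have h3 := le_saddle (s := a • s + b • t) hC hR (by
    have := convex_convexHull ℝ ((fun a => (a, u a, inner ℝ (u a) a)) '' A) hs ht ha hb hab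
    simpa [graphHull] using this) y
  simp only [Prod.fst_add, Prod.smul_fst, Prod.snd_add, Prod.smul_snd, inner_add_left,
    real_inner_smul_left, smul_eq_mul] at h1 h2 h3 ⊢
  have hb' : b = 1 - a := by linarith
  have h4 := mul_le_mul_of_nonneg_left h1.le ha
  have h5 := mul_le_mul_of_nonneg_left h2.le hb
  have h6 : a * ε + b * ε = ε := by rw [← add_mul, hab, one_mul]
  linarith

lemma convexOn_saddle (hmid : MidpointDense A Ω) (hC : ∀ a ∈ A, ‖u a‖ ≤ C)
    (hR : ∀ a ∈ A, ‖a‖ ≤ R) (hΩ : Convex ℝ Ω) {x : E d} (hx : x ∈ Ω) :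
    ConvexOn ℝ Ω (fun y => saddle u A x y) := by
  refine ⟨hΩ, fun y _ z _ a b ha hb hab => ?_⟩
  refine csSup_le (hmid.saddleValues_nonempty (u := u) hC hx _) ?_
  rintro _ ⟨s, hs, rfl⟩
  have h4 := mul_le_mul_of_nonneg_left (le_saddle hC hR hs y) ha
  have h5 := mul_le_mul_of_nonneg_left (le_saddle hC hR hs z) hb
  have h6 : a * s.2 + b * s.2 = s.2 := by rw [← add_mul, hab, one_mul]
  simp only [inner_add_right, real_inner_smul_right, smul_eq_mul]
  linarith

lemma lipschitzWith_saddle (hmid : MidpointDense A Ω) (hC : ∀ a ∈ A, ‖u a‖ ≤ C)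
    (hR : ∀ a ∈ A, ‖a‖ ≤ R) {x : E d} (hx : x ∈ Ω) :
    LipschitzWith C.toNNReal (saddle u A x) := by
  have hC0 : 0 ≤ C := by
    obtain ⟨v, -, h1, -⟩ := hmid x hx 1 one_pos
    exact (norm_nonneg _).trans (hC _ h1)
  refine LipschitzWith.of_le_add_mul _ fun y z => ?_
  rw [Real.coe_toNNReal _ hC0]
  refine csSup_le (hmid.saddleValues_nonempty (u := u) hC hx _) ?_
  rintro _ ⟨s, hs, rfl⟩
  have h1 := le_saddle hC hR hs z
  have h2 := real_inner_le_norm s.1 (y - z)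
  have h3 := mul_le_mul_of_nonneg_right (norm_le_of_mem_graphHull hC hs) (norm_nonneg (y - z))
  rw [inner_sub_right] at h2
  rw [dist_eq_norm]
  simp only at h3 ⊢
  linarith

/-- Concavity gives continuity in `x`, and the Lipschitz constant in `y` does not depend on `x`.
Joint continuity is needed to build a continuous Hamiltonian from the envelope. -/
lemma continuousOn_saddle (hmid : MidpointDense A Ω) (hC : ∀ a ∈ A, ‖u a‖ ≤ C)
    (hR : ∀ a ∈ A, ‖a‖ ≤ R) (hΩ : Convex ℝ Ω) (hΩo : IsOpen Ω) :
    ContinuousOn (fun p : E d × E d => saddle u A p.1 p.2) (Ω ×ˢ Ω) :=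
  continuousOn_prod_of_continuousOn_lipschitzOnWith' _ C.toNNReal
    (fun _ hx => (lipschitzWith_saddle hmid hC hR hx).lipschitzOnWith)
    fun y _ => (concaveOn_saddle hmid hC hR hΩ y).continuousOn hΩo

end Saddle

open Filter Topology Metric

/-! ### Normalized Lebesgue measure -/

section NormalizedVolume

variable {d : ℕ} {Ω : Set (E d)}

lemma normalizedVolume_eq (Ω : Set (E d)) :
    normalizedVolume Ω = (volume Ω)⁻¹ • volume.restrict Ω := rfl

lemma isProbabilityMeasure_normalizedVolume (hΩo : IsOpen Ω) (hΩb : Bornology.IsBounded Ω)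
    (hΩn : Ω.Nonempty) : IsProbabilityMeasure (normalizedVolume Ω) :=
  ProbabilityTheory.cond_isProbabilityMeasure_of_finite (hΩo.measure_pos volume hΩn).ne'
    hΩb.measure_lt_top.ne

lemma normalizedVolume_absolutelyContinuous (Ω : Set (E d)) :
    normalizedVolume Ω ≪ volume.restrict Ω :=
  Measure.smul_absolutelyContinuous

lemma ae_normalizedVolume {p : E d → Prop} (hΩ : MeasurableSet Ω)
    (h : ∀ᵐ x ∂volume, x ∈ Ω → p x) : ∀ᵐ x ∂(normalizedVolume Ω), p x :=
  normalizedVolume_absolutelyContinuous Ω ((ae_restrict_iff' hΩ).2 h)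

lemma ae_mem_normalizedVolume (hΩ : MeasurableSet Ω) : ∀ᵐ x ∂(normalizedVolume Ω), x ∈ Ω :=
  ae_normalizedVolume hΩ (Eventually.of_forall fun _ h => h)

lemma integral_normalizedVolume (Ω : Set (E d)) (f : E d → ℝ) :
    ∫ x, f x ∂(normalizedVolume Ω) = (volume Ω).toReal⁻¹ * ∫ x in Ω, f x := by
  rw [normalizedVolume_eq, integral_smul_measure, ENNReal.toReal_inv, smul_eq_mul]

end NormalizedVolume

/-! ### Almost everywhere continuity and the diagonal gradient -/

section Differentiation

variable {d n : ℕ} {u : E d → E d} {Ω Ω₀ : Set (E d)} {C : ℝ}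

lemma dense_compl_of_null (h₀ : volume Ω₀ = 0) : Dense Ω₀ᶜ :=
  Measure.dense_of_ae (p := fun x => x ∉ Ω₀) (compl_mem_ae_iff.2 h₀)

/-- For almost every `v`, both `x + v` and `x - v` avoid the null set, so such `v` are dense near
`0`. -/
lemma midpointDense_diff_null (hΩo : IsOpen Ω) (h₀ : volume Ω₀ = 0) :
    MidpointDense (Ω \ Ω₀) Ω := by
  intro x hx ε hε
  have hae : ∀ᵐ y ∂(volume : Measure (E d)), y ∉ Ω₀ := compl_mem_ae_iff.2 h₀
  have h1 : ∀ᵐ v ∂(volume : Measure (E d)), x + v ∉ Ω₀ :=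
    (measurePreserving_add_left volume x).quasiMeasurePreserving.ae hae
  have h2 : ∀ᵐ v ∂(volume : Measure (E d)), x - v ∉ Ω₀ :=
    (Measure.measurePreserving_sub_left volume x).quasiMeasurePreserving.ae hae
  have hd := Measure.dense_of_ae (h1.and h2)
  have hopen : IsOpen {v : E d | ‖v‖ < ε ∧ x + v ∈ Ω ∧ x - v ∈ Ω} :=
    (isOpen_lt continuous_norm continuous_const).inter
      ((hΩo.preimage (continuous_const.add continuous_id)).inter
        (hΩo.preimage (continuous_const.sub continuous_id)))
  obtain ⟨v, ⟨hv, hv1, hv2⟩, hv3, hv4⟩ := hd.inter_open_nonempty _ hopen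
    ⟨0, by simpa using hε, by simpa using hx, by simpa using hx⟩
  exact ⟨v, hv, ⟨hv1, hv3⟩, hv2, hv4⟩

lemma integrable_indicator_of_bounded (hΩo : IsOpen Ω) (hΩb : Bornology.IsBounded Ω)
    (hu : AEMeasurable u (volume.restrict Ω)) (hC : ∀ x ∈ Ω, ‖u x‖ ≤ C) :
    Integrable (Ω.indicator u) volume := by
  rw [integrable_indicator_iff hΩo.measurableSet]
  have : IsFiniteMeasure (volume.restrict Ω) := ⟨by simpa using hΩb.measure_lt_top⟩
  exact Integrable.of_bound hu.aestronglyMeasurable C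
    ((ae_restrict_iff' hΩo.measurableSet).2 (Eventually.of_forall hC))

/-- A bounded vector field that is monotone on a set of full measure is continuous along that set
at almost every point. -/
lemma ae_continuousWithinAt_of_monotone (hΩo : IsOpen Ω) (hΩb : Bornology.IsBounded Ω)
    (hu : AEMeasurable u (volume.restrict Ω)) (hC : ∀ x ∈ Ω, ‖u x‖ ≤ C) (h₀ : volume Ω₀ = 0)
    (hmono : ∀ x ∈ Ω \ Ω₀, ∀ y ∈ Ω \ Ω₀, 0 ≤ inner ℝ (u x - u y) (x - y)) :
    ∀ᵐ x ∂volume, x ∈ Ω \ Ω₀ → ContinuousWithinAt u (Ω \ Ω₀) x := by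
  have hint := integrable_indicator_of_bounded hΩo hΩb hu hC
  -- The eccentricity of the balls used below grows as `ε` shrinks, so differentiation is required
  -- for all integers `K` at once.
  have hleb := ae_all_iff.2 fun K : ℕ =>
    IsUnifLocDoublingMeasure.ae_tendsto_average (μ := (volume : Measure (E d)))
      hint.locallyIntegrable (K : ℝ)
  filter_upwards [hleb] with x hx hxA
  rw [← continuousWithinAt_sdiff_self]
  rw [ContinuousWithinAt, Metric.tendsto_nhds]
  intro ε hε
  have hC0 : 0 ≤ C := (norm_nonneg _).trans (hC x hxA.1)
  -- This makes the monotonicity error `2 * C / t` smaller than `ε / 2`.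
  obtain ⟨t, ht⟩ := exists_nat_gt (4 * C / ε)
  have ht0 : (0 : ℝ) < t := lt_of_le_of_lt (by positivity) ht
  set l := 𝓝[(Ω \ Ω₀) \ {x}] x with hl
  set e : E d → E d := fun y => ‖u y - u x‖⁻¹ • (u y - u x) with he
  have he1 : ∀ y, ‖e y‖ ≤ 1 := by
    intro y
    rw [he, norm_smul, norm_inv, norm_norm]
    exact inv_mul_le_one
  set δ : E d → ℝ := fun y => ‖y - x‖ with hδ
  -- The averaging ball, of radius `δ y`, is pushed from `y` in the direction `e y` of the jump `u y
  -- - u x`. Monotonicity between `y` and the points `z` of this ball forces `⟨e y, u z⟩ ≥ ⟨e y, u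
  -- y⟩ - 2C/t`, while the average of `u` over it tends to `u x`.
  set w : E d → E d := fun y => y + (t * δ y) • e y with hw
  have hwx : ∀ y, ‖w y - x‖ ≤ (t + 1) * δ y := by
    intro y
    have : w y - x = (y - x) + (t * δ y) • e y := add_sub_right_comm _ _ _
    rw [this]
    refine (norm_add_le _ _).trans ?_
    rw [norm_smul, Real.norm_of_nonneg (by positivity)]
    have := mul_le_mul_of_nonneg_left (he1 y) (show 0 ≤ t * δ y by positivity)
    change δ y + _ ≤ _
    linarith
  have hδ0 : Tendsto δ l (𝓝 0) := by
    have : Tendsto δ (𝓝 x) (𝓝 (δ x)) := (continuous_id.sub continuous_const).norm.tendsto x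
    simp only [hδ, sub_self, norm_zero] at this
    exact this.mono_left nhdsWithin_le_nhds
  have hδlim : Tendsto δ l (𝓝[>] 0) := by
    refine tendsto_nhdsWithin_iff.2 ⟨hδ0, ?_⟩
    filter_upwards [self_mem_nhdsWithin] with y hy
    exact norm_pos_iff.2 (sub_ne_zero.2 hy.2)
  have havg := hx (t + 1) w δ hδlim (Eventually.of_forall fun y => by
    rw [mem_closedBall, dist_comm, dist_eq_norm]
    push_cast
    exact hwx y)
  rw [Set.indicator_of_mem hxA.1] at havg
  obtain ⟨ρ, hρ, hρΩ⟩ := Metric.isOpen_iff.1 hΩo x hxA.1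
  have hsmall : ∀ᶠ y in l, (t + 2) * δ y < ρ := by
    have : Tendsto (fun y => ((t : ℝ) + 2) * δ y) l (𝓝 (((t : ℝ) + 2) * 0)) := hδ0.const_mul _
    rw [mul_zero] at this
    exact this.eventually (gt_mem_nhds hρ)
  have hclose := (Metric.tendsto_nhds.1 havg) (ε / 2) (half_pos hε)
  filter_upwards [hsmall, hclose, hδlim.eventually self_mem_nhdsWithin, self_mem_nhdsWithin]
    with y hyρ hyavg hyδ hyA
  have hyδ' : 0 < δ y := hyδ
  have hsub : closedBall (w y) (δ y) ⊆ Ω := by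
    intro z hz
    apply hρΩ
    rw [mem_closedBall, dist_eq_norm] at hz
    rw [mem_ball, dist_eq_norm]
    calc ‖z - x‖ ≤ ‖z - w y‖ + ‖w y - x‖ := norm_sub_le_norm_sub_add_norm_sub _ _ _
      _ ≤ δ y + (t + 1) * δ y := add_le_add hz (hwx y)
      _ < ρ := by linarith
  set m := ⨍ z in closedBall (w y) (δ y), Ω.indicator u z with hm
  -- The bound defines a closed half-space, so it passes from almost every value to the average.
  have hmem : m ∈ {p : E d | inner ℝ (e y) (u y) - 2 * C / t ≤ inner ℝ (e y) p} := by
    refine Convex.set_average_mem ?_ ?_ ?_ ?_ ?_ hint.integrableOn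
    · exact convex_halfSpace_ge (innerₗ (E d) (e y)).isLinear _
    · exact isClosed_le continuous_const (continuous_const.inner continuous_id)
    · exact (measure_closedBall_pos volume _ hyδ').ne'
    · exact isBounded_closedBall.measure_lt_top.ne
    · have hae : ∀ᵐ z ∂(volume : Measure (E d)), z ∉ Ω₀ := compl_mem_ae_iff.2 h₀
      refine (ae_restrict_iff' isClosed_closedBall.measurableSet).2 ?_
      filter_upwards [hae] with z hz hzb
      have hzΩ := hsub hzb
      change _ ≤ inner ℝ (e y) (Ω.indicator u z)
      rw [Set.indicator_of_mem hzΩ]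
      have h1 := hmono y hyA.1 z ⟨hzΩ, hz⟩
      have h2 : y - z = (w y - z) - (t * δ y) • e y := by simp only [hw]; module
      rw [h2, inner_sub_right, real_inner_smul_right] at h1
      have h3 : inner ℝ (u y - u z) (w y - z) ≤ 2 * C * δ y := by
        refine (real_inner_le_norm _ _).trans ?_
        rw [mem_closedBall, dist_comm, dist_eq_norm] at hzb
        refine mul_le_mul ?_ hzb (norm_nonneg _) (by positivity)
        refine (norm_sub_le _ _).trans ?_
        linarith [hC y hyA.1.1, hC z hzΩ]
      have h4 : δ y * (t * inner ℝ (u y - u z) (e y)) ≤ δ y * (2 * C) := by linarith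
      have h5 := le_of_mul_le_mul_left h4 hyδ'
      have h6 : inner ℝ (u y - u z) (e y) ≤ 2 * C / t := by
        rw [le_div_iff₀ ht0]; linarith
      rw [real_inner_comm, inner_sub_right] at h6
      linarith
  have h1 : inner ℝ (e y) (u y - u x) = ‖u y - u x‖ := by
    rw [he, real_inner_smul_left, real_inner_self_eq_norm_sq, sq]
    rw [← mul_assoc, inv_mul_mul_self]
  have h2 : inner ℝ (e y) (m - u x) ≤ ‖m - u x‖ := by
    refine (real_inner_le_norm _ _).trans ?_
    exact mul_le_of_le_one_left (norm_nonneg _) (he1 y)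
  have h3 : inner ℝ (e y) (u y) - 2 * C / t ≤ inner ℝ (e y) m := hmem
  rw [inner_sub_right] at h1 h2
  rw [dist_eq_norm] at hyavg ⊢
  have h4 : 2 * C / t < ε / 2 := by
    rw [div_lt_iff₀ hε] at ht
    rw [div_lt_iff₀ ht0]
    linarith
  linarith

/-- On `A` the linearization error lies between `0` and `⟨u y - u x, y - x⟩`, which is `o(‖y - x‖)`
by continuity of `u` along `A`. The resulting bound is a closed condition, so it extends to the
closure. -/
lemma hasGradientAt_of_inner_le {A : Set (E d)} (hΩo : IsOpen Ω)
    (hdense : Ω ⊆ closure A) {F : E d → ℝ} (hF : Continuous F) {x : E d} (hx : x ∈ Ω)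
    (hFx : F x = 0) (hlo : ∀ y ∈ A, inner ℝ (u x) (y - x) ≤ F y)
    (hhi : ∀ y ∈ A, F y ≤ inner ℝ (u y) (y - x)) (hcont : ContinuousWithinAt u A x) :
    HasGradientAt F (u x) x := by
  rw [hasGradientAt_iff_isLittleO, Asymptotics.isLittleO_iff]
  intro c hc
  obtain ⟨ρ, hρ, hρΩ⟩ := Metric.isOpen_iff.1 hΩo x hx
  obtain ⟨r, hr, hru⟩ := Metric.continuousWithinAt_iff.1 hcont c hc
  have hclosed : IsClosed {y : E d | ‖F y - F x - inner ℝ (u x) (y - x)‖ ≤ c * ‖y - x‖} :=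
    isClosed_le (by fun_prop) (by fun_prop)
  have hsub : ball x (min ρ r) ∩ A ⊆
      {y : E d | ‖F y - F x - inner ℝ (u x) (y - x)‖ ≤ c * ‖y - x‖} := by
    rintro y ⟨hyb, hyA⟩
    rw [Set.mem_ofPred_eq, hFx, sub_zero,
      Real.norm_of_nonneg (sub_nonneg.2 (hlo y hyA))]
    have h1 := hhi y hyA
    have h2 := real_inner_le_norm (u y - u x) (y - x)
    have h3 := hru hyA ((mem_ball.1 hyb).trans_le (min_le_right _ _))
    rw [dist_eq_norm] at h3
    have h4 := mul_le_mul_of_nonneg_right h3.le (norm_nonneg (y - x))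
    rw [inner_sub_left] at h2
    linarith
  filter_upwards [ball_mem_nhds x (lt_min hρ hr)] with y hy
  refine closure_minimal hsub hclosed ?_
  refine isOpen_ball.inter_closure ⟨hy, hdense (hρΩ ?_)⟩
  exact ball_subset_ball (min_le_left _ _) hy

/-- A bounded cyclically monotone vector field is the diagonal gradient of a continuous
concave-convex cyclically sub-antisymmetric function. -/
theorem exists_saddle_of_isCyclicallyMonotoneOn (hΩo : IsOpen Ω) (hΩc : Convex ℝ Ω)
    (hΩb : Bornology.IsBounded Ω) (hu : AEMeasurable u (volume.restrict Ω))
    (hC : ∀ x ∈ Ω, ‖u x‖ ≤ C) (h₀ : volume Ω₀ = 0)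
    (hcyc : IsCyclicallyMonotoneOn (n + 2) u (Ω \ Ω₀)) :
    ∃ F : E d → E d → ℝ, IsCyclicallySubAntisymmetricOn (n + 2) F Ω ∧
      (∀ y ∈ Ω, ConcaveOn ℝ Ω (fun x => F x y)) ∧
      (∀ x ∈ Ω, ConvexOn ℝ Ω (fun y => F x y)) ∧
      (∀ᵐ x ∂(normalizedVolume Ω), HasGradientAt (fun y => F x y) (u x) x) ∧
      ContinuousOn (fun p : E d × E d => F p.1 p.2) (Ω ×ˢ Ω) ∧
      ∀ x ∈ Ω \ Ω₀, ∀ y, inner ℝ (u x) (y - x) ≤ F x y := by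
  have hmid := midpointDense_diff_null hΩo h₀
  obtain ⟨R, hR⟩ := hΩb.exists_norm_le
  have hCA : ∀ a ∈ Ω \ Ω₀, ‖u a‖ ≤ C := fun a ha => hC a ha.1
  have hRA : ∀ a ∈ Ω \ Ω₀, ‖a‖ ≤ R := fun a ha => hR a ha.1
  refine ⟨saddle u (Ω \ Ω₀), isCyclicallySubAntisymmetricOn_saddle hcyc hmid hCA hRA,
    fun y _ => concaveOn_saddle hmid hCA hRA hΩc y, fun x hx => convexOn_saddle hmid hCA hRA hΩc hx,
    ae_normalizedVolume hΩo.measurableSet ?_, continuousOn_saddle hmid hCA hRA hΩc hΩo,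
    fun x hx y => inner_le_saddle hCA hRA hx y⟩
  have hae : ∀ᵐ z ∂(volume : Measure (E d)), z ∉ Ω₀ := compl_mem_ae_iff.2 h₀
  filter_upwards [hae, ae_continuousWithinAt_of_monotone hΩo hΩb hu hC h₀
    fun x hx y hy => hcyc.monotone hx hy] with x hx0 hx hxΩ
  refine hasGradientAt_of_inner_le hΩo
    ((dense_compl_of_null h₀).open_subset_closure_inter hΩo)
    (lipschitzWith_saddle hmid hCA hRA hxΩ).continuous hxΩ (saddle_self hcyc hmid hCA hRA hxΩ)
    (fun y _ => inner_le_saddle hCA hRA ⟨hxΩ, hx0⟩ y)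
    (fun y hy => saddle_le_inner hcyc hmid hCA hRA Set.sdiff_subset hxΩ hy) (hx ⟨hxΩ, hx0⟩)

/-- The subgradient inequality for a differentiable convex function. -/
lemma inner_le_of_convexOn_of_hasGradientAt {f : E d → ℝ} {p x y : E d} (hf : ConvexOn ℝ Ω f)
    (hx : x ∈ Ω) (hy : y ∈ Ω) (hp : HasGradientAt f p x) : inner ℝ p (y - x) ≤ f y - f x := by
  have hline : HasDerivAt (fun t : ℝ => f (AffineMap.lineMap x y t)) (inner ℝ p (y - x)) 0 := by
    have h1 : HasDerivAt (AffineMap.lineMap x y : ℝ → E d) (y - x) 0 := AffineMap.hasDerivAt_lineMap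
    have h2 : HasFDerivAt f (InnerProductSpace.toDual ℝ (E d) p)
        ((AffineMap.lineMap x y : ℝ → E d) 0) := by
      rw [AffineMap.lineMap_apply_zero]; exact hp.hasFDerivAt
    exact h2.comp_hasDerivAt 0 h1
  have hconv : ConvexOn ℝ (Set.Icc (0 : ℝ) 1) (fun t : ℝ => f (AffineMap.lineMap x y t)) := by
    refine (hf.comp_affineMap (AffineMap.lineMap x y)).subset ?_ (convex_Icc 0 1)
    exact fun t ht => hf.1.lineMap_mem hx hy ht
  have := hconv.le_slope_of_hasDerivAt (x := 0) (y := 1) (by simp) (by simp) one_pos hline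
  simpa [slope_def_field] using this

/-- Since `F x x = 0`, convexity gives `⟨u x, y - x⟩ ≤ F x y`; sum this around the cycle. -/
lemma isCyclicallyMonotoneOn_of_gradient {N : ℕ} [NeZero N] {F : E d → E d → ℝ}
    (hF : IsCyclicallySubAntisymmetricOn N F Ω)
    (hconv : ∀ x ∈ Ω, ConvexOn ℝ Ω (fun y => F x y)) {A : Set (E d)} (hAΩ : A ⊆ Ω)
    (hgrad : ∀ x ∈ A, HasGradientAt (fun y => F x y) (u x) x) : IsCyclicallyMonotoneOn N u A := by
  intro x hx
  have h1 : ∀ i, -inner ℝ (u (x i)) (x i - x (i + 1)) ≤ F (x i) (x (i + 1)) := by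
    intro i
    have := inner_le_of_convexOn_of_hasGradientAt (hconv _ (hAΩ (hx i))) (hAΩ (hx i))
      (hAΩ (hx (i + 1))) (hgrad _ (hx i))
    rw [hF.1 _ (hAΩ (hx i)), sub_zero] at this
    rwa [← inner_neg_right, neg_sub]
  have h2 := Finset.sum_le_sum fun i (_ : i ∈ Finset.univ) => h1 i
  rw [Finset.sum_neg_distrib] at h2
  linarith [hF.2 x fun i => hAΩ (hx i)]

end Differentiation

/-! ### Symmetric plans and orbits of measure preserving maps -/

section Plans

variable {d n : ℕ} {u : E d → E d} {Ω : Set (E d)} {C R : ℝ}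

lemma integrable_normalizedVolume_of_bounded (hΩo : IsOpen Ω) (hΩb : Bornology.IsBounded Ω)
    (hΩn : Ω.Nonempty) {f : E d → ℝ} (hf : AEStronglyMeasurable f (normalizedVolume Ω)) {B : ℝ}
    (hB : ∀ x ∈ Ω, ‖f x‖ ≤ B) : Integrable f (normalizedVolume Ω) := by
  have := isProbabilityMeasure_normalizedVolume hΩo hΩb hΩn
  refine Integrable.of_bound hf B ?_
  filter_upwards [ae_mem_normalizedVolume hΩo.measurableSet] with x hx using hB x hx

lemma aemeasurable_normalizedVolume (hu : AEMeasurable u (volume.restrict Ω)) :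
    AEMeasurable u (normalizedVolume Ω) :=
  hu.mono_ac (normalizedVolume_absolutelyContinuous Ω)

lemma measurableSet_power (hΩ : MeasurableSet Ω) (N : ℕ) : MeasurableSet (power Ω N) := by
  have : power Ω N = ⋂ i, (fun x : Fin N → E d => x i) ⁻¹' Ω := by
    ext x; simp [power]
  rw [this]
  exact MeasurableSet.iInter fun i => measurable_pi_apply i hΩ

/-- Invariance under the shift carries the first marginal to all the others. -/
lemma measurePreserving_eval_of_mem_symmetricPlans {N : ℕ} [NeZero N]
    {π : Measure (Fin N → E d)} (hπ : π ∈ symmetricPlans Ω N) (i : Fin N) :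
    MeasurePreserving (fun x : Fin N → E d => x i) π (normalizedVolume Ω) := by
  obtain ⟨-, -, hσ, h0⟩ := hπ
  suffices h : ∀ k : ℕ, MeasurePreserving (fun x : Fin N → E d => x (Fin.ofNat N k)) π
      (normalizedVolume Ω) by
    simpa using h i
  intro k
  induction k with
  | zero => exact ⟨measurable_pi_apply _, h0⟩
  | succ k ih =>
    convert ih.comp hσ using 2 with x
    simp only [Function.comp, cyclicShift]
    congr 1
    ext
    simp [Fin.val_add]

lemma inner_bound (hC : ∀ x ∈ Ω, ‖u x‖ ≤ C) (hR : ∀ x ∈ Ω, ‖x‖ ≤ R) {x y z : E d} (hx : x ∈ Ω)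
    (hy : y ∈ Ω) (hz : z ∈ Ω) : ‖inner ℝ (u x) (y - z)‖ ≤ C * (R + R) :=
  (norm_inner_le_norm _ _).trans <| mul_le_mul (hC x hx)
    ((norm_sub_le _ _).trans (add_le_add (hR y hy) (hR z hz))) (norm_nonneg _)
    ((norm_nonneg _).trans (hC x hx))

lemma integrable_plan_inner {N : ℕ} [NeZero N] (hu : AEMeasurable u (volume.restrict Ω))
    (hC : ∀ x ∈ Ω, ‖u x‖ ≤ C) (hR : ∀ x ∈ Ω, ‖x‖ ≤ R) {π : Measure (Fin N → E d)}
    (hπ : π ∈ symmetricPlans Ω N) (i j : Fin N) :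
    Integrable (fun x => inner ℝ (u (x i)) (x i - x j)) π := by
  have := hπ.1
  have hui : AEMeasurable (fun x : Fin N → E d => u (x i)) π :=
    AEMeasurable.comp_quasiMeasurePreserving (aemeasurable_normalizedVolume hu)
      (measurePreserving_eval_of_mem_symmetricPlans hπ i).quasiMeasurePreserving
  refine Integrable.of_bound (hui.aestronglyMeasurable.inner
    (by fun_prop : Measurable fun x : Fin N → E d => x i - x j).aestronglyMeasurable)
    (C * (R + R)) ?_
  filter_upwards [hπ.2.1] with x hx using inner_bound hC hR (hx i) (hx i) (hx j)

/-- Along a symmetric plan, the cost of the first pair is the average cost of a cycle. -/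
lemma nonneg_integral_of_mem_symmetricPlans {N : ℕ} [NeZero N] (hΩ : MeasurableSet Ω)
    (hu : AEMeasurable u (volume.restrict Ω)) (hC : ∀ x ∈ Ω, ‖u x‖ ≤ C) (hR : ∀ x ∈ Ω, ‖x‖ ≤ R)
    {Ω₀ : Set (E d)} (h₀ : volume Ω₀ = 0) (hcyc : IsCyclicallyMonotoneOn N u (Ω \ Ω₀))
    {π : Measure (Fin N → E d)} (hπ : π ∈ symmetricPlans Ω N) :
    0 ≤ ∫ x, inner ℝ (u (x 0)) (x 0 - x (0 + 1)) ∂π := by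
  have hint := fun i : Fin N => integrable_plan_inner hu hC hR hπ i (i + 1)
  -- Changing variables by the shift raises the index by one, so all `N` terms of the cycle have the
  -- same integral.
  have hstep : ∀ k : ℕ, ∫ x, inner ℝ (u (x (Fin.ofNat N k)))
      (x (Fin.ofNat N k) - x (Fin.ofNat N k + 1)) ∂π =
      ∫ x, inner ℝ (u (x 0)) (x 0 - x (0 + 1)) ∂π := by
    intro k
    induction k with
    | zero => rfl
    | succ k ih =>
      have hσ := hπ.2.2.1
      have h1 : Fin.ofNat N (k + 1) = Fin.ofNat N k + 1 := by
        ext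
        simp [Fin.val_add]
      have h2 := integral_map hσ.measurable.aemeasurable
        (f := fun x : Fin N → E d => (inner ℝ (u (x (Fin.ofNat N k)))
          (x (Fin.ofNat N k) - x (Fin.ofNat N k + 1)) : ℝ))
        (by rw [hσ.map_eq]; exact (hint _).aestronglyMeasurable)
      rw [hσ.map_eq, ih] at h2
      rw [h2, h1]
      rfl
  have hall : ∀ i : Fin N, ∫ x, inner ℝ (u (x i)) (x i - x (i + 1)) ∂π =
      ∫ x, inner ℝ (u (x 0)) (x 0 - x (0 + 1)) ∂π := fun i => by
    simpa using hstep i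
  have hsum : 0 ≤ ∑ i : Fin N, ∫ x, inner ℝ (u (x i)) (x i - x (i + 1)) ∂π := by
    rw [← integral_finsetSum _ fun i _ => hint i]
    refine integral_nonneg_of_ae ?_
    have hae : ∀ᵐ z ∂(normalizedVolume Ω), z ∉ Ω₀ :=
      ae_normalizedVolume hΩ (Eventually.mono (compl_mem_ae_iff.2 h₀ : ∀ᵐ z, z ∉ Ω₀)
        fun _ h _ => h)
    have hπae : ∀ᵐ x ∂π, ∀ i, x i ∉ Ω₀ := ae_all_iff.2 fun i =>
      (measurePreserving_eval_of_mem_symmetricPlans hπ i).quasiMeasurePreserving.ae hae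
    filter_upwards [hπ.2.1, hπae] with x hx hx0
    exact hcyc x fun i => ⟨hx i, hx0 i⟩
  simp only [hall, Finset.sum_const, Finset.card_univ, Fintype.card_fin, nsmul_eq_mul] at hsum
  exact nonneg_of_mul_nonneg_right hsum (by exact_mod_cast Nat.pos_of_ne_zero (NeZero.ne N))

lemma id_mem_measurePreservingInvolutions (Ω : Set (E d)) (N : ℕ) :
    id ∈ measurePreservingInvolutions Ω N :=
  ⟨Set.mapsTo_id Ω, MeasurePreserving.id _, Eventually.of_forall fun x => by simp⟩

/-- The orbits of a measure preserving involution of order `N` form a symmetric plan. -/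
lemma map_orbit_mem_symmetricPlans (hΩo : IsOpen Ω) (hΩb : Bornology.IsBounded Ω)
    (hΩn : Ω.Nonempty) {N : ℕ} [NeZero N] {S : E d → E d}
    (hS : S ∈ measurePreservingInvolutions Ω N) :
    (normalizedVolume Ω).map (fun x (i : Fin N) => S^[i] x) ∈ symmetricPlans Ω N := by
  obtain ⟨hmaps, hmp, hN⟩ := hS
  have hP := isProbabilityMeasure_normalizedVolume hΩo hΩb hΩn
  have hT : Measurable fun x (i : Fin N) => S^[i] x :=
    measurable_pi_lambda _ fun i => hmp.measurable.iterate i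
  have hσ : Measurable (cyclicShift : (Fin N → E d) → Fin N → E d) :=
    measurable_pi_lambda _ fun i => measurable_pi_apply _
  refine ⟨Measure.isProbabilityMeasure_map hT.aemeasurable, ?_, ⟨hσ, ?_⟩, ?_⟩
  · refine (ae_map_iff hT.aemeasurable (measurableSet_power hΩo.measurableSet N)).2 ?_
    filter_upwards [ae_mem_normalizedVolume hΩo.measurableSet] with x hx i
    exact hmaps.iterate i hx
  -- Shifting the orbit of `x` gives the orbit of `S x`; the last coordinate wraps around by `S^N =
  -- I`, whence equality only almost everywhere.
  · have hcongr : cyclicShift ∘ (fun x (i : Fin N) => S^[i] x) =ᵐ[normalizedVolume Ω]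
        (fun x (i : Fin N) => S^[i] x) ∘ S := by
      filter_upwards [hN] with x hx
      funext i
      simp only [Function.comp, cyclicShift, ← Function.iterate_succ_apply]
      rw [Fin.val_add, Fin.val_one', Nat.add_mod_mod]
      rcases (Nat.succ_le_of_lt i.2).lt_or_eq with h | h
      · rw [Nat.mod_eq_of_lt h]
      · have h' : (i : ℕ) + 1 = N := h
        rw [Nat.succ_eq_add_one, h', Nat.mod_self, hx, Function.iterate_zero_apply]
    rw [Measure.map_map hσ hT, Measure.map_congr hcongr, ← Measure.map_map hT hmp.measurable,
      hmp.map_eq]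
  · rw [Measure.map_map (measurable_pi_apply _) hT]
    exact Measure.map_id

lemma integral_map_orbit (hΩo : IsOpen Ω) (hΩb : Bornology.IsBounded Ω) (hΩn : Ω.Nonempty)
    (hu : AEMeasurable u (volume.restrict Ω)) (hC : ∀ x ∈ Ω, ‖u x‖ ≤ C)
    (hR : ∀ x ∈ Ω, ‖x‖ ≤ R) {S : E d → E d}
    (hS : S ∈ measurePreservingInvolutions Ω (n + 2)) :
    ∫ x, inner ℝ (u (x 0)) (x 0 - x 1)
      ∂((normalizedVolume Ω).map (fun x (i : Fin (n + 2)) => S^[i] x)) =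
      ∫ x, inner ℝ (u x) (x - S x) ∂(normalizedVolume Ω) := by
  have hT : Measurable fun x (i : Fin (n + 2)) => S^[i] x :=
    measurable_pi_lambda _ fun i => hS.2.1.measurable.iterate i
  rw [integral_map hT.aemeasurable (integrable_plan_inner hu hC hR
    (map_orbit_mem_symmetricPlans hΩo hΩb hΩn hS) 0 1).aestronglyMeasurable]
  rfl

lemma orbit_id (N : ℕ) : (fun (x : E d) (i : Fin N) => id^[i] x) = fun x _ => x := by
  simp

end Plans

/-! ### The polar condition and its variational forms -/

section Polar

variable {d n : ℕ} {u : E d → E d} {Ω : Set (E d)} {C R : ℝ}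

/-- The identity belongs to the class and has cost `0`, so only the lower bound carries information.
-/
lemma isGLB_polar_iff {N : ℕ} :
    IsGLB ((fun S : E d → E d => ∫ x, inner ℝ (u x) (x - S x) ∂(normalizedVolume Ω)) ''
        measurePreservingInvolutions Ω N) 0 ↔
      ∀ S ∈ measurePreservingInvolutions Ω N,
        0 ≤ ∫ x, inner ℝ (u x) (x - S x) ∂(normalizedVolume Ω) := by
  constructor
  · exact fun h S hS => h.1 ⟨S, hS, rfl⟩
  · refine fun h => IsLeast.isGLB ⟨⟨id, id_mem_measurePreservingInvolutions Ω N, by simp⟩, ?_⟩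
    rintro _ ⟨S, hS, rfl⟩
    exact h S hS

lemma integrable_inner_sub (hΩo : IsOpen Ω) (hΩb : Bornology.IsBounded Ω) (hΩn : Ω.Nonempty)
    (hu : AEMeasurable u (volume.restrict Ω)) (hC : ∀ x ∈ Ω, ‖u x‖ ≤ C)
    (hR : ∀ x ∈ Ω, ‖x‖ ≤ R) {S : E d → E d} (hS : Measurable S) (hSΩ : Set.MapsTo S Ω Ω) :
    Integrable (fun x => inner ℝ (u x) (x - S x)) (normalizedVolume Ω) :=
  integrable_normalizedVolume_of_bounded hΩo hΩb hΩn
    ((aemeasurable_normalizedVolume hu).aestronglyMeasurable.inner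
      (by fun_prop : Measurable fun x => x - S x).aestronglyMeasurable)
    fun _ hx => inner_bound hC hR hx hx (hSΩ hx)

lemma integrable_inner_self (hΩo : IsOpen Ω) (hΩb : Bornology.IsBounded Ω) (hΩn : Ω.Nonempty)
    (hu : AEMeasurable u (volume.restrict Ω)) (hC : ∀ x ∈ Ω, ‖u x‖ ≤ C)
    (hR : ∀ x ∈ Ω, ‖x‖ ≤ R) : Integrable (fun x => inner ℝ (u x) x) (normalizedVolume Ω) :=
  integrable_normalizedVolume_of_bounded hΩo hΩb hΩn
    ((aemeasurable_normalizedVolume hu).aestronglyMeasurable.inner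
      measurable_id.aestronglyMeasurable)
    fun x hx => (norm_inner_le_norm _ _).trans <| mul_le_mul (hC x hx) (hR x hx) (norm_nonneg _)
      ((norm_nonneg _).trans (hC x hx))

lemma integral_inner_comp (hΩo : IsOpen Ω) (hΩb : Bornology.IsBounded Ω) (hΩn : Ω.Nonempty)
    (hu : AEMeasurable u (volume.restrict Ω)) (hC : ∀ x ∈ Ω, ‖u x‖ ≤ C)
    (hR : ∀ x ∈ Ω, ‖x‖ ≤ R) {N : ℕ} {S : E d → E d}
    (hS : S ∈ measurePreservingInvolutions Ω N) :
    ∫ x, inner ℝ (u x) (S x) ∂(normalizedVolume Ω) =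
      ∫ x, inner ℝ (u x) x ∂(normalizedVolume Ω) -
        ∫ x, inner ℝ (u x) (x - S x) ∂(normalizedVolume Ω) := by
  rw [← integral_sub (integrable_inner_self hΩo hΩb hΩn hu hC hR)
    (integrable_inner_sub hΩo hΩb hΩn hu hC hR hS.2.1.measurable hS.1)]
  refine integral_congr_ae (Eventually.of_forall fun x => ?_)
  simp only [inner_sub_right]
  ring

lemma isMaxOn_iff (hΩo : IsOpen Ω) (hΩb : Bornology.IsBounded Ω) (hΩn : Ω.Nonempty)
    (hu : AEMeasurable u (volume.restrict Ω)) (hC : ∀ x ∈ Ω, ‖u x‖ ≤ C)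
    (hR : ∀ x ∈ Ω, ‖x‖ ≤ R) {N : ℕ} :
    IsMaxOn (fun S : E d → E d => ∫ x, inner ℝ (u x) (S x) ∂(normalizedVolume Ω))
        (measurePreservingInvolutions Ω N) id ↔
      ∀ S ∈ measurePreservingInvolutions Ω N,
        0 ≤ ∫ x, inner ℝ (u x) (x - S x) ∂(normalizedVolume Ω) := by
  refine _root_.isMaxOn_iff.trans (forall₂_congr fun S hS => ?_)
  rw [integral_inner_comp hΩo hΩb hΩn hu hC hR hS]
  simp

/-- Because `S` preserves the measure, `∫ ‖S x‖² = ∫ ‖x‖²`, and only the cross term survives. -/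
lemma integral_norm_sub_sq (hΩo : IsOpen Ω) (hΩb : Bornology.IsBounded Ω) (hΩn : Ω.Nonempty)
    (hu : AEMeasurable u (volume.restrict Ω)) (hC : ∀ x ∈ Ω, ‖u x‖ ≤ C)
    (hR : ∀ x ∈ Ω, ‖x‖ ≤ R) {N : ℕ} {S : E d → E d}
    (hS : S ∈ measurePreservingInvolutions Ω N) :
    ∫ x, ‖u x - S x‖ ^ 2 ∂(normalizedVolume Ω) = ∫ x, ‖u x - x‖ ^ 2 ∂(normalizedVolume Ω) +
      2 * ∫ x, inner ℝ (u x) (x - S x) ∂(normalizedVolume Ω) := by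
  have hSm := hS.2.1.measurable
  have hu' := (aemeasurable_normalizedVolume hu).aestronglyMeasurable
  have hsq : ∀ {f : E d → E d} {B : ℝ}, AEStronglyMeasurable f (normalizedVolume Ω) →
      (∀ x ∈ Ω, ‖f x‖ ≤ B) → Integrable (fun x => ‖f x‖ ^ 2) (normalizedVolume Ω) := by
    intro f B hf hB
    refine integrable_normalizedVolume_of_bounded hΩo hΩb hΩn (hf.norm.pow 2) (B := B ^ 2) ?_
    intro x hx
    rw [Real.norm_of_nonneg (by positivity)]
    exact pow_le_pow_left₀ (norm_nonneg _) (hB x hx) 2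
  have i1 : Integrable (fun x => ‖u x - x‖ ^ 2) (normalizedVolume Ω) := hsq (hu'.sub measurable_id.aestronglyMeasurable) (B := C + R) fun x hx =>
    (norm_sub_le _ _).trans (add_le_add (hC x hx) (hR x hx))
  have i2 := integrable_inner_sub hΩo hΩb hΩn hu hC hR hSm hS.1
  have i3 := hsq hSm.aestronglyMeasurable fun x hx => hR _ (hS.1 hx)
  have i4 := hsq (f := id) measurable_id.aestronglyMeasurable hR
  have h34 : ∫ x, ‖S x‖ ^ 2 ∂(normalizedVolume Ω) = ∫ x, ‖id x‖ ^ 2 ∂(normalizedVolume Ω) := by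
    have := integral_map hSm.aemeasurable (μ := normalizedVolume Ω) (f := fun x : E d => ‖x‖ ^ 2)
      (by fun_prop)
    rw [hS.2.1.map_eq] at this
    exact this.symm
  have hexp : ∀ x, ‖u x - S x‖ ^ 2 =
      ‖u x - x‖ ^ 2 + 2 * inner ℝ (u x) (x - S x) + (‖S x‖ ^ 2 - ‖id x‖ ^ 2) := by
    intro x
    rw [norm_sub_sq_real, norm_sub_sq_real, inner_sub_right, id]
    ring
  simp only [hexp]
  have e1 : Integrable (fun x => ‖u x - x‖ ^ 2 + 2 * inner ℝ (u x) (x - S x))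
      (normalizedVolume Ω) := i1.add (i2.const_mul 2)
  have e2 : Integrable (fun x => ‖S x‖ ^ 2 - ‖id x‖ ^ 2) (normalizedVolume Ω) := i3.sub i4
  rw [integral_add e1 e2, integral_sub i3 i4, h34, sub_self, add_zero]
  rw [integral_add i1 (i2.const_mul 2), integral_const_mul]

lemma isGLB_norm_sq_iff (hΩo : IsOpen Ω) (hΩb : Bornology.IsBounded Ω) (hΩn : Ω.Nonempty)
    (hu : AEMeasurable u (volume.restrict Ω)) (hC : ∀ x ∈ Ω, ‖u x‖ ≤ C)
    (hR : ∀ x ∈ Ω, ‖x‖ ≤ R) {N : ℕ} :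
    IsGLB ((fun S : E d → E d => ∫ x, ‖u x - S x‖ ^ 2 ∂(normalizedVolume Ω)) ''
        measurePreservingInvolutions Ω N) (∫ x, ‖u x - x‖ ^ 2 ∂(normalizedVolume Ω)) ↔
      ∀ S ∈ measurePreservingInvolutions Ω N,
        0 ≤ ∫ x, inner ℝ (u x) (x - S x) ∂(normalizedVolume Ω) := by
  constructor
  · intro h S hS
    have : _ ≤ ∫ x, ‖u x - S x‖ ^ 2 ∂(normalizedVolume Ω) := h.1 ⟨S, hS, rfl⟩
    rw [integral_norm_sub_sq hΩo hΩb hΩn hu hC hR hS] at this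
    linarith
  · refine fun h => IsLeast.isGLB ⟨⟨id, id_mem_measurePreservingInvolutions Ω N, rfl⟩, ?_⟩
    rintro _ ⟨S, hS, rfl⟩
    simp only
    rw [integral_norm_sub_sq hΩo hΩb hΩn hu hC hR hS]
    linarith [h S hS]

end Polar

/-! ### From maps to points: cyclic permutation of small balls -/

section BallRotation

variable {d N : ℕ} [NeZero N] {u : E d → E d} {Ω : Set (E d)} {C R : ℝ}

/-- The map translating each ball `closedBall (c i) r` onto `closedBall (c (i + 1)) r` and fixing
the other points. -/
noncomputable def ballRotation (c : Fin N → E d) (r : ℝ) (y : E d) : E d :=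
  y + ∑ i, (closedBall (c i) r).indicator (fun _ => c (i + 1) - c i) y

variable {c : Fin N → E d} {r : ℝ}

lemma measurable_ballRotation : Measurable (ballRotation c r) :=
  measurable_id.add (Finset.measurable_sum _ fun _ _ =>
    measurable_const.indicator isClosed_closedBall.measurableSet)

lemma sum_indicator_closedBall {N : ℕ} {c : Fin N → E d} (hdisj : Pairwise fun i j => Disjoint (closedBall (c i) r)
    (closedBall (c j) r)) {M : Type*} [AddCommMonoid M] (g : Fin N → E d → M) {i : Fin N} {y : E d}
    (hy : y ∈ closedBall (c i) r) : ∑ j, (closedBall (c j) r).indicator (g j) y = g i y := by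
  rw [Finset.sum_eq_single i, Set.indicator_of_mem hy]
  · intro j _ hj
    exact Set.indicator_of_notMem (Set.disjoint_right.1 (hdisj hj) hy) _
  · simp

lemma ballRotation_of_mem (hdisj : Pairwise fun i j => Disjoint (closedBall (c i) r)
    (closedBall (c j) r)) {i : Fin N} {y : E d} (hy : y ∈ closedBall (c i) r) :
    ballRotation c r y = y + (c (i + 1) - c i) := by
  rw [ballRotation, sum_indicator_closedBall hdisj _ hy]

lemma ballRotation_mem (hdisj : Pairwise fun i j => Disjoint (closedBall (c i) r)
    (closedBall (c j) r)) {i : Fin N} {y : E d} (hy : y ∈ closedBall (c i) r) :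
    ballRotation c r y ∈ closedBall (c (i + 1)) r := by
  rw [ballRotation_of_mem hdisj hy, mem_closedBall, dist_eq_norm]
  rw [mem_closedBall, dist_eq_norm] at hy
  convert hy using 2
  abel

lemma ballRotation_of_forall_notMem {y : E d} (hy : ∀ i, y ∉ closedBall (c i) r) :
    ballRotation c r y = y := by
  rw [ballRotation, Finset.sum_eq_zero fun i _ => Set.indicator_of_notMem (hy i) _, add_zero]

lemma iterate_ballRotation (hdisj : Pairwise fun i j => Disjoint (closedBall (c i) r)
    (closedBall (c j) r)) (y : E d) : (ballRotation c r)^[N] y = y := by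
  by_cases h : ∃ i, y ∈ closedBall (c i) r
  · obtain ⟨i, hi⟩ := h
    -- The translations telescope along the cycle of centres, which closes up after `N` steps.
    have key : ∀ k : ℕ, (ballRotation c r)^[k] y ∈ closedBall (c (i + Fin.ofNat N k)) r ∧
        (ballRotation c r)^[k] y = y + (c (i + Fin.ofNat N k) - c i) := by
      intro k
      induction k with
      | zero =>
        have : i + Fin.ofNat N 0 = i := add_zero i
        rw [this]
        simpa using hi
      | succ k ih =>
        have h1 : i + Fin.ofNat N (k + 1) = i + Fin.ofNat N k + 1 := by
          rw [add_assoc]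
          congr 1
          ext
          simp [Fin.val_add]
        rw [Function.iterate_succ_apply', h1]
        refine ⟨ballRotation_mem hdisj ih.1, ?_⟩
        rw [ballRotation_of_mem hdisj ih.1, ih.2]
        abel
    have hN : i + Fin.ofNat N N = i := by
      have : Fin.ofNat N N = 0 := by ext; simp
      rw [this, add_zero]
    rw [(key N).2, hN, sub_self, add_zero]
  · push Not at h
    exact Function.iterate_fixed (ballRotation_of_forall_notMem h) N

lemma measurePreserving_ballRotation (hdisj : Pairwise fun i j => Disjoint (closedBall (c i) r)
    (closedBall (c j) r)) : MeasurePreserving (ballRotation c r) volume volume := by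
  refine ⟨measurable_ballRotation, Measure.ext fun A hA => ?_⟩
  rw [Measure.map_apply measurable_ballRotation hA]
  have hB : ∀ i, MeasurableSet (closedBall (c i) r) := fun i => isClosed_closedBall.measurableSet
  have hD : MeasurableSet (⋃ i, closedBall (c i) r) := MeasurableSet.iUnion hB
  have hsplit : ∀ A : Set (E d), MeasurableSet A →
      volume A = ∑ i, volume (A ∩ closedBall (c i) r) +
        volume (A \ ⋃ i, closedBall (c i) r) := by
    intro A hA
    rw [← measure_inter_add_sdiff A hD, Set.inter_iUnion, measure_iUnion, tsum_fintype]
    · exact fun i j hij => (hdisj hij).mono Set.inter_subset_right Set.inter_subset_right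
    · exact fun i => hA.inter (hB i)
  rw [hsplit _ (measurable_ballRotation hA), hsplit A hA]
  congr 1
  -- The part of `A` in ball `i + 1` is the translate of the part of its preimage in ball `i`.
  · rw [← sum_shift fun i => volume (A ∩ closedBall (c i) r)]
    refine Finset.sum_congr rfl fun i _ => ?_
    rw [← measure_preimage_add_right volume (c (i + 1) - c i) (A ∩ closedBall (c (i + 1)) r)]
    congr 1
    ext y
    have hiff : y + (c (i + 1) - c i) ∈ closedBall (c (i + 1)) r ↔ y ∈ closedBall (c i) r := by
      rw [mem_closedBall, mem_closedBall, dist_eq_norm, dist_eq_norm]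
      have : y + (c (i + 1) - c i) - c (i + 1) = y - c i := by abel
      rw [this]
    simp only [Set.mem_inter_iff, Set.mem_preimage, hiff]
    refine and_congr_left fun hy => ?_
    rw [ballRotation_of_mem hdisj hy]
  · congr 1
    ext y
    simp only [Set.mem_sdiff, Set.mem_preimage, Set.mem_iUnion, not_exists]
    refine and_congr_left fun hy => ?_
    rw [ballRotation_of_forall_notMem hy]

lemma ballRotation_mem_iff (hdisj : Pairwise fun i j => Disjoint (closedBall (c i) r)
    (closedBall (c j) r)) (hsub : ∀ i, closedBall (c i) r ⊆ Ω) (y : E d) :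
    ballRotation c r y ∈ Ω ↔ y ∈ Ω := by
  by_cases h : ∃ i, y ∈ closedBall (c i) r
  · obtain ⟨i, hi⟩ := h
    exact iff_of_true (hsub _ (ballRotation_mem hdisj hi)) (hsub _ hi)
  · push Not at h
    rw [ballRotation_of_forall_notMem h]

lemma ballRotation_mem_measurePreservingInvolutions (hΩ : MeasurableSet Ω)
    (hdisj : Pairwise fun i j => Disjoint (closedBall (c i) r) (closedBall (c j) r))
    (hsub : ∀ i, closedBall (c i) r ⊆ Ω) :
    ballRotation c r ∈ measurePreservingInvolutions Ω N := by
  refine ⟨fun y hy => (ballRotation_mem_iff hdisj hsub y).2 hy, ?_,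
    Eventually.of_forall (iterate_ballRotation hdisj)⟩
  have h := (measurePreserving_ballRotation hdisj).restrict_preimage hΩ
  have hpre : ballRotation c r ⁻¹' Ω = Ω := Set.ext (ballRotation_mem_iff hdisj hsub)
  rw [hpre] at h
  exact h.smul_measure (volume Ω)⁻¹

/-- For the ball rotation, `x - S x` is the constant `c i - c (i + 1)` on each ball and `0`
elsewhere; the polar integral is then a sum of averages times positive factors, the common ball
volume and the normalization. -/
lemma sum_inner_average_nonneg (hΩo : IsOpen Ω) (hΩb : Bornology.IsBounded Ω) (hΩn : Ω.Nonempty)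
    (hint : Integrable (Ω.indicator u) volume)
    (hpol : ∀ S ∈ measurePreservingInvolutions Ω N,
      0 ≤ ∫ x, inner ℝ (u x) (x - S x) ∂(normalizedVolume Ω)) (hr : 0 < r)
    (hdisj : Pairwise fun i j => Disjoint (closedBall (c i) r) (closedBall (c j) r))
    (hsub : ∀ i, closedBall (c i) r ⊆ Ω) :
    0 ≤ ∑ i, inner ℝ (⨍ y in closedBall (c i) r, Ω.indicator u y) (c i - c (i + 1)) := by
  have h := hpol _ (ballRotation_mem_measurePreservingInvolutions hΩo.measurableSet hdisj hsub)
  rw [integral_normalizedVolume, ← integral_indicator hΩo.measurableSet] at h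
  have hvol : 0 < (volume Ω).toReal⁻¹ :=
    inv_pos.2 (ENNReal.toReal_pos (hΩo.measure_pos volume hΩn).ne' hΩb.measure_lt_top.ne)
  have h' := nonneg_of_mul_nonneg_right h hvol
  have hfun : (Ω.indicator fun x => inner ℝ (u x) (x - ballRotation c r x)) = fun x =>
      ∑ i, (closedBall (c i) r).indicator
        (fun x => inner ℝ (c i - c (i + 1)) (Ω.indicator u x)) x := by
    funext x
    by_cases hx : ∃ i, x ∈ closedBall (c i) r
    · obtain ⟨i, hi⟩ := hx
      rw [sum_indicator_closedBall hdisj _ hi, Set.indicator_of_mem (hsub i hi),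
        Set.indicator_of_mem (hsub i hi), ballRotation_of_mem hdisj hi, real_inner_comm]
      congr 1
      abel
    · push Not at hx
      rw [Finset.sum_eq_zero fun i _ => Set.indicator_of_notMem (hx i) _]
      classical rw [Set.indicator_apply, ballRotation_of_forall_notMem hx]
      simp
  have hi : ∀ i, Integrable (fun x => inner ℝ (c i - c (i + 1)) (Ω.indicator u x))
      (volume : Measure (E d)) := fun i => hint.const_inner _
  rw [hfun, integral_finsetSum _ fun i _ =>
    (hi i).indicator isClosed_closedBall.measurableSet] at h'
  have hball : ∀ i, ∫ x, (closedBall (c i) r).indicator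
      (fun x => inner ℝ (c i - c (i + 1)) (Ω.indicator u x)) x =
      volume.real (closedBall (0 : E d) r) *
        inner ℝ (⨍ y in closedBall (c i) r, Ω.indicator u y) (c i - c (i + 1)) := by
    intro i
    rw [integral_indicator isClosed_closedBall.measurableSet, integral_inner hint.integrableOn,
      ← measure_smul_setAverage _ isBounded_closedBall.measure_lt_top.ne,
      real_inner_smul_right, real_inner_comm, measureReal_def, measureReal_def,
      Measure.addHaar_closedBall_center]
  rw [Finset.sum_congr rfl fun i _ => hball i, ← Finset.mul_sum] at h'
  exact nonneg_of_mul_nonneg_right h' (ENNReal.toReal_pos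
    (measure_closedBall_pos volume _ hr).ne' isBounded_closedBall.measure_lt_top.ne)

/-- A vector field in the polar of the measure preserving involutions of order `N` is
`N`-cyclically monotone almost everywhere. -/
theorem exists_isCyclicallyMonotoneOn_of_polar (hΩo : IsOpen Ω) (hΩb : Bornology.IsBounded Ω)
    (hΩn : Ω.Nonempty) (hu : AEMeasurable u (volume.restrict Ω)) (hC : ∀ x ∈ Ω, ‖u x‖ ≤ C)
    (hpol : ∀ S ∈ measurePreservingInvolutions Ω N,
      0 ≤ ∫ x, inner ℝ (u x) (x - S x) ∂(normalizedVolume Ω)) :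
    ∃ Ω₀ : Set (E d), volume Ω₀ = 0 ∧ IsCyclicallyMonotoneOn N u (Ω \ Ω₀) := by
  -- In dimension `0` there is no unit vector along which to separate balls, and the inequality is
  -- trivial.
  rcases subsingleton_or_nontrivial (E d) with hsing | hnontriv
  · refine ⟨∅, by simp, fun x _ => Finset.sum_nonneg fun i _ => ?_⟩
    rw [Subsingleton.elim (x i - x (i + 1)) 0, inner_zero_right]
  obtain ⟨e, he⟩ := exists_norm_eq (E d) zero_le_one
  have hint := integrable_indicator_of_bounded hΩo hΩb hu hC
  -- Quantifying over all families of centres keeps the exceptional null set independent of the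
  -- cycle.
  have hleb : ∀ᵐ x ∂(volume : Measure (E d)), ∀ w : ℝ → E d,
      (∀ᶠ r in 𝓝[>] 0, x ∈ closedBall (w r) (3 * N * r)) →
      Tendsto (fun r => ⨍ y in closedBall (w r) r, Ω.indicator u y) (𝓝[>] 0)
        (𝓝 (Ω.indicator u x)) := by
    filter_upwards [IsUnifLocDoublingMeasure.ae_tendsto_average (μ := (volume : Measure (E d)))
      hint.locallyIntegrable (3 * N : ℝ)] with x hx w hw using hx w (fun r => r) tendsto_id hw
  refine ⟨_, hleb, fun x hx => ?_⟩
  have hxΩ : ∀ i, x i ∈ Ω := fun i => (hx i).1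
  have hxL := fun i => Set.notMem_compl_iff.1 (hx i).2
  -- The `x i` need not be distinct. Offsets that are multiples of `3r` separate coinciding points
  -- by more than `2r`, while `x i` stays within `3Nr` of its centre, as differentiation requires.
  set c : ℝ → Fin N → E d := fun r i => x i + (3 * r * (i : ℕ)) • e with hc
  have hcx : ∀ i, Tendsto (fun r => c r i) (𝓝[>] 0) (𝓝 (x i)) := by
    intro i
    have : Continuous fun r => c r i := by fun_prop
    have := this.tendsto 0
    simp only [hc, mul_zero, zero_mul, zero_smul, add_zero] at this
    exact this.mono_left nhdsWithin_le_nhds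
  have hpos : ∀ᶠ r : ℝ in 𝓝[>] 0, 0 < r := self_mem_nhdsWithin
  have hnorm : ∀ (i : Fin N) {r : ℝ}, 0 < r → ‖(3 * r * (i : ℕ)) • e‖ = 3 * r * (i : ℕ) := by
    intro i r hr
    rw [norm_smul, he, mul_one, Real.norm_of_nonneg (by positivity)]
  have havg : ∀ i, Tendsto (fun r => ⨍ y in closedBall (c r i) r, Ω.indicator u y) (𝓝[>] 0)
      (𝓝 (u (x i))) := by
    intro i
    have := hxL i (fun r => c r i) (by
      filter_upwards [hpos] with r hr
      rw [mem_closedBall, dist_comm, dist_eq_norm]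
      have h1 : c r i - x i = (3 * r * (i : ℕ)) • e := add_sub_cancel_left _ _
      have h2 : ((i : ℕ) : ℝ) ≤ N := by exact_mod_cast i.2.le
      rw [h1, hnorm i hr]
      nlinarith)
    rwa [Set.indicator_of_mem (hxΩ i)] at this
  have hlim : Tendsto (fun r => ∑ i, inner ℝ (⨍ y in closedBall (c r i) r, Ω.indicator u y)
      (c r i - c r (i + 1))) (𝓝[>] 0) (𝓝 (∑ i, inner ℝ (u (x i)) (x i - x (i + 1)))) :=
    tendsto_finsetSum _ fun i _ => (havg i).inner ((hcx i).sub (hcx (i + 1)))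
  refine ge_of_tendsto hlim ?_
  have hdisj : ∀ᶠ r : ℝ in 𝓝[>] 0, ∀ i j : Fin N, i ≠ j → r + r < dist (c r i) (c r j) := by
    refine eventually_all.2 fun i => eventually_all.2 fun j => ?_
    by_cases hij : i = j
    · exact Eventually.of_forall fun r h => absurd hij h
    by_cases hxij : x i = x j
    · filter_upwards [hpos] with r hr _
      have h1 : c r i - c r j = (3 * r * ((i : ℕ) - (j : ℕ) : ℝ)) • e := by
        simp only [hc, hxij]; module
      have h2 : (1 : ℝ) ≤ |((i : ℕ) : ℝ) - (j : ℕ)| := by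
        have h3 : ((i : ℕ) : ℤ) - (j : ℕ) ≠ 0 := by
          intro h; exact hij (Fin.ext (by omega))
        exact_mod_cast Int.one_le_abs h3
      rw [dist_eq_norm, h1, norm_smul, he, mul_one, Real.norm_eq_abs, abs_mul,
        abs_of_pos (by positivity : (0 : ℝ) < 3 * r)]
      nlinarith
    · have h1 : Tendsto (fun r : ℝ => r + r) (𝓝[>] 0) (𝓝 0) := by
        have : Tendsto (fun r : ℝ => r + r) (𝓝 0) (𝓝 (0 + 0)) :=
          (continuous_id.add continuous_id).tendsto 0
        rw [add_zero] at this
        exact this.mono_left nhdsWithin_le_nhds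
      have h2 := (hcx i).dist (hcx j)
      filter_upwards [h1.eventually_lt h2 (dist_pos.2 hxij)] with r hr _ using hr
  have hsub : ∀ᶠ r : ℝ in 𝓝[>] 0, ∀ i : Fin N, closedBall (c r i) r ⊆ Ω := by
    refine eventually_all.2 fun i => ?_
    obtain ⟨ρ, hρ, hρΩ⟩ := Metric.isOpen_iff.1 hΩo _ (hxΩ i)
    have h1 : Tendsto (fun r : ℝ => r + dist (c r i) (x i)) (𝓝[>] 0)
        (𝓝 (0 + dist (x i) (x i))) :=
      (tendsto_id.mono_left nhdsWithin_le_nhds).add ((hcx i).dist tendsto_const_nhds)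
    rw [dist_self, add_zero] at h1
    filter_upwards [h1.eventually (gt_mem_nhds hρ)] with r hr y hy
    exact hρΩ ((dist_triangle _ (c r i) _).trans_lt
      ((add_le_add_left (mem_closedBall.1 hy) _).trans_lt hr))
  filter_upwards [hdisj, hsub, hpos] with r h1 h2 h3
  exact sum_inner_average_nonneg hΩo hΩb hΩn hint hpol h3
    (fun i j hij => closedBall_disjoint_closedBall (h1 i j hij)) h2

end BallRotation

/-! ### Antisymmetric Hamiltonians and duality -/

section Hamiltonians

variable {d n : ℕ} {u : E d → E d} {Ω : Set (E d)} {C R : ℝ}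

/-- Lower integrals are monotone for arbitrary functions, so the measurability of `L_H` never
enters. -/
lemma extIntegral_mono_ae {μ : Measure (E d)} {f g : E d → EReal} (h : ∀ᵐ x ∂μ, f x ≤ g x) :
    extIntegral μ f ≤ extIntegral μ g := by
  refine EReal.sub_le_sub ?_ ?_
  · exact EReal.coe_ennreal_le_coe_ennreal_iff.2
      (lintegral_mono_ae (h.mono fun x hx => EReal.toENNReal_le_toENNReal hx))
  · exact EReal.coe_ennreal_le_coe_ennreal_iff.2
      (lintegral_mono_ae (h.mono fun x hx =>
        EReal.toENNReal_le_toENNReal (EReal.neg_le_neg_iff.2 hx)))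

lemma extIntegral_coe {μ : Measure (E d)} {g : E d → ℝ} (hg : Integrable g μ) :
    extIntegral μ (fun x => (g x : EReal)) = ((∫ x, g x ∂μ : ℝ) : EReal) := by
  have hcoe : ∀ t : ℝ, (t : EReal).toENNReal = ENNReal.ofReal t := fun t => by
    rw [EReal.toENNReal_of_ne_top (EReal.coe_ne_top t), EReal.toReal_coe]
  rw [integral_eq_lintegral_pos_part_sub_lintegral_neg_part hg, EReal.coe_sub]
  simp only [extIntegral, ← EReal.coe_neg, hcoe]
  have hneg : ∫⁻ x, ENNReal.ofReal (-g x) ∂μ ≠ ⊤ := hg.neg.lintegral_lt_top.ne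
  rw [EReal.coe_ennreal_toReal hg.lintegral_lt_top.ne, EReal.coe_ennreal_toReal hneg]

lemma iterate_cyclicShift {N : ℕ} [NeZero N] (k : ℕ) (x : Fin N → E d) (i : Fin N) :
    cyclicShift^[k] x i = x (i + Fin.ofNat N k) := by
  induction k generalizing x with
  | zero => exact congrArg x (add_zero i).symm
  | succ k ih =>
    rw [Function.iterate_succ_apply, ih, cyclicShift, add_assoc]
    congr 2
    ext
    simp [Fin.val_add]

lemma apply_const_of_mem_antisymmetricHamiltonians {N : ℕ} [NeZero N] {H : (Fin N → E d) → ℝ}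
    (hH : H ∈ antisymmetricHamiltonians Ω N) {x : E d} (hx : x ∈ Ω) : H (fun _ => x) = 0 := by
  have h := hH.2 (fun _ => x) fun _ => hx
  have hfix : ∀ k : ℕ, cyclicShift^[k] (fun _ : Fin N => x) = fun _ => x :=
    fun k => funext fun i => iterate_cyclicShift k _ i
  simp only [hfix, Finset.sum_const, Finset.card_range, nsmul_eq_mul] at h
  exact (mul_eq_zero.1 h).resolve_left (Nat.cast_ne_zero.2 (NeZero.ne N))

lemma sum_inner_single {m : ℕ} (p : E d) (y : Fin (m + 1) → E d) :
    ∑ i, inner ℝ ((Pi.single 0 p : Fin (m + 1) → E d) i) (y i) = inner ℝ p (y 0) := by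
  rw [Finset.sum_eq_single 0, Pi.single_eq_same]
  · intro i _ hi
    rw [Pi.single_eq_of_ne hi, inner_zero_left]
  · simp

/-- Test the supremum at `y = (x, …, x)`, where `H` vanishes. -/
lemma inner_le_legendre {H : (Fin (n + 2) → E d) → ℝ}
    (hH : H ∈ antisymmetricHamiltonians Ω (n + 2)) {x : E d} (hx : x ∈ Ω) (p : E d) :
    ((inner ℝ p x : ℝ) : EReal) ≤ legendre Ω H x (Pi.single 0 p : Fin (n + 1) → E d) := by
  have hconst : (Fin.cons x fun _ : Fin (n + 1) => x : Fin (n + 2) → E d) = fun _ => x := by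
    funext i
    refine Fin.cases rfl (fun _ => rfl) i
  refine le_iSup₂_of_le (fun _ => x) (fun _ => hx) (EReal.coe_le_coe_iff.2 ?_)
  rw [sum_inner_single, hconst, apply_const_of_mem_antisymmetricHamiltonians hH hx, sub_zero]

/-- The antisymmetrization `F (x_0, x_1) - N⁻¹ ∑ F (x_i, x_{i+1})`. -/
noncomputable def antisymmetrization {d : ℕ} (N : ℕ) [NeZero N] (F : E d → E d → ℝ)
    (x : Fin N → E d) : ℝ :=
  F (x 0) (x (0 + 1)) - (N : ℝ)⁻¹ * ∑ i, F (x i) (x (i + 1))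

/-- The cyclic sum is shift-invariant, so subtracting `N⁻¹` times it cancels the sum over the
shifts. -/
lemma antisymmetrization_mem {N : ℕ} [NeZero N] {F : E d → E d → ℝ}
    (hF : ContinuousOn (fun p : E d × E d => F p.1 p.2) (Ω ×ˢ Ω)) :
    antisymmetrization N F ∈ antisymmetricHamiltonians Ω N := by
  have hcont : ∀ i : Fin N, ContinuousOn (fun x : Fin N → E d => F (x i) (x (i + 1)))
      (power Ω N) := fun i =>
    hF.comp (f := fun x : Fin N → E d => (x i, x (i + 1)))
      (by fun_prop) fun x hx => ⟨hx i, hx (i + 1)⟩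
  refine ⟨(hcont 0).sub (continuousOn_const.mul (continuousOn_finsetSum _ fun i _ => hcont i)),
    fun x _ => ?_⟩
  have hinv : ∀ k : ℕ, ∑ i, F (cyclicShift^[k] x i) (cyclicShift^[k] x (i + 1)) =
      ∑ i, F (x i) (x (i + 1)) := by
    intro k
    simp only [iterate_cyclicShift, add_right_comm _ (1 : Fin N)]
    exact Equiv.sum_comp (Equiv.addRight (Fin.ofNat N k)) fun i => F (x i) (x (i + 1))
  simp only [antisymmetrization, hinv, Finset.sum_sub_distrib, Finset.sum_const,
    Finset.card_range, nsmul_eq_mul]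
  rw [mul_inv_cancel_left₀ (Nat.cast_ne_zero.2 (NeZero.ne N)), sub_eq_zero,
    Finset.sum_range]
  refine Finset.sum_congr rfl fun i _ => ?_
  rw [iterate_cyclicShift, iterate_cyclicShift, Fin.ofNat_val_eq_self, zero_add, zero_add,
    add_comm]

lemma le_antisymmetrization {N : ℕ} [NeZero N] {F : E d → E d → ℝ}
    (hF : IsCyclicallySubAntisymmetricOn N F Ω) {x : Fin N → E d} (hx : x ∈ power Ω N) :
    F (x 0) (x (0 + 1)) ≤ antisymmetrization N F x := by
  have h := mul_nonpos_of_nonneg_of_nonpos (by positivity : (0 : ℝ) ≤ (N : ℝ)⁻¹) (hF.2 x hx)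
  rw [antisymmetrization]
  linarith

/-- Sub-antisymmetry puts the antisymmetrization above `F x (y 0)`, hence above `⟨p, y 0 - x⟩`. -/
lemma legendre_antisymmetrization_le {F : E d → E d → ℝ}
    (hF : IsCyclicallySubAntisymmetricOn (n + 2) F Ω) {x p : E d} (hx : x ∈ Ω)
    (hp : ∀ y, inner ℝ p (y - x) ≤ F x y) :
    legendre Ω (antisymmetrization (n + 2) F) x (Pi.single 0 p : Fin (n + 1) → E d) ≤
      ((inner ℝ p x : ℝ) : EReal) := by
  refine iSup₂_le fun y hy => EReal.coe_le_coe_iff.2 ?_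
  rw [sum_inner_single]
  have hmem : (Fin.cons x y : Fin (n + 2) → E d) ∈ power Ω (n + 2) := by
    intro i
    refine Fin.cases ?_ (fun j => ?_) i
    · exact hx
    · exact hy j
  have h1 := le_antisymmetrization hF hmem
  have h2 : F ((Fin.cons x y : Fin (n + 2) → E d) 0)
      ((Fin.cons x y : Fin (n + 2) → E d) (0 + 1)) = F x (y 0) := by
    rw [zero_add]; rfl
  rw [h2] at h1
  have h3 := hp (y 0)
  rw [inner_sub_right] at h3
  linarith

/-- The duality formula between antisymmetric Hamiltonians and measure preserving involutions, for
a cyclically monotone vector field. -/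
theorem iInf_extIntegral_legendre (hΩo : IsOpen Ω) (hΩc : Convex ℝ Ω)
    (hΩb : Bornology.IsBounded Ω) (hΩn : Ω.Nonempty) (hu : AEMeasurable u (volume.restrict Ω))
    (hC : ∀ x ∈ Ω, ‖u x‖ ≤ C) (hR : ∀ x ∈ Ω, ‖x‖ ≤ R) {Ω₀ : Set (E d)} (h₀ : volume Ω₀ = 0)
    (hcyc : IsCyclicallyMonotoneOn (n + 2) u (Ω \ Ω₀)) :
    (⨅ H ∈ antisymmetricHamiltonians Ω (n + 2), extIntegral (normalizedVolume Ω)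
      (fun x => legendre Ω H x (Pi.single 0 (u x) : Fin (n + 1) → E d))) =
      ((∫ x, inner ℝ (u x) x ∂(normalizedVolume Ω) : ℝ) : EReal) := by
  rw [← extIntegral_coe (integrable_inner_self hΩo hΩb hΩn hu hC hR)]
  apply le_antisymm
  · obtain ⟨F, hF, -, -, -, hcont, hlow⟩ :=
      exists_saddle_of_isCyclicallyMonotoneOn hΩo hΩc hΩb hu hC h₀ hcyc
    refine iInf₂_le_of_le _ (antisymmetrization_mem hcont) (extIntegral_mono_ae ?_)
    refine ae_normalizedVolume hΩo.measurableSet ?_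
    have hae : ∀ᵐ z ∂(volume : Measure (E d)), z ∉ Ω₀ := compl_mem_ae_iff.2 h₀
    filter_upwards [hae] with x hx0 hx
    exact legendre_antisymmetrization_le hF hx (hlow x ⟨hx, hx0⟩)
  · refine le_iInf₂ fun H hH => extIntegral_mono_ae ?_
    filter_upwards [ae_mem_normalizedVolume hΩo.measurableSet] with x hx
    exact inner_le_legendre hH hx (u x)

lemma iSup_integral_inner {N : ℕ}
    (hmax : IsMaxOn (fun S : E d → E d => ∫ x, inner ℝ (u x) (S x) ∂(normalizedVolume Ω))
      (measurePreservingInvolutions Ω N) id) :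
    (⨆ S ∈ measurePreservingInvolutions Ω N,
      ((∫ x, inner ℝ (u x) (S x) ∂(normalizedVolume Ω) : ℝ) : EReal)) =
      ((∫ x, inner ℝ (u x) x ∂(normalizedVolume Ω) : ℝ) : EReal) :=
  le_antisymm (iSup₂_le fun _ hS => EReal.coe_le_coe_iff.2 (hmax hS))
    (le_iSup₂_of_le id (id_mem_measurePreservingInvolutions Ω N) le_rfl)

end Hamiltonians

end CyclicMonotone

/-! ### The equivalences -/

/-- Here `N = n + 2` runs over all integers `N ≥ 2`; the coordinates of a point of `Ω^N` are
numbered from `0`, and `Pi.single 0 (u x)` is the `(N - 1)`-tuple `(u x, 0, …, 0)`. -/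
theorem mainTheorem4 {d : ℕ} (n : ℕ) (Ω : Set (CyclicMonotone.E d)) (hΩ_open : IsOpen Ω)
    (hΩ_convex : Convex ℝ Ω) (hΩ_bounded : Bornology.IsBounded Ω) (hΩ_nonempty : Ω.Nonempty)
    (u : CyclicMonotone.E d → CyclicMonotone.E d)
    (hu_meas : AEMeasurable u (volume.restrict Ω)) (hu_bdd : ∃ C : ℝ, ∀ x ∈ Ω, ‖u x‖ ≤ C) :
    List.TFAE [
      ∃ Ω₀ : Set (CyclicMonotone.E d), volume Ω₀ = 0 ∧
        CyclicMonotone.IsCyclicallyMonotoneOn (n + 2) u (Ω \ Ω₀),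
      IsGLB ((fun π : Measure (Fin (n + 2) → CyclicMonotone.E d) =>
            ∫ x, inner ℝ (u (x 0)) (x 0 - x 1) ∂π) ''
          CyclicMonotone.symmetricPlans Ω (n + 2)) 0 ∧
        (CyclicMonotone.normalizedVolume Ω).map (fun x (_ : Fin (n + 2)) => x) ∈
          CyclicMonotone.symmetricPlans Ω (n + 2) ∧
        ∫ x, inner ℝ (u (x 0)) (x 0 - x 1)
          ∂((CyclicMonotone.normalizedVolume Ω).map (fun x (_ : Fin (n + 2)) => x)) = 0,
      IsGLB ((fun S : CyclicMonotone.E d → CyclicMonotone.E d =>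
            ∫ x, inner ℝ (u x) (x - S x) ∂(CyclicMonotone.normalizedVolume Ω)) ''
          CyclicMonotone.measurePreservingInvolutions Ω (n + 2)) 0,
      IsGLB ((fun S : CyclicMonotone.E d → CyclicMonotone.E d =>
            ∫ x, ‖u x - S x‖ ^ 2 ∂(CyclicMonotone.normalizedVolume Ω)) ''
          CyclicMonotone.measurePreservingInvolutions Ω (n + 2))
        (∫ x, ‖u x - x‖ ^ 2 ∂(CyclicMonotone.normalizedVolume Ω)),
      ∃ H : CyclicMonotone.E d → CyclicMonotone.E d → ℝ,
        CyclicMonotone.IsCyclicallySubAntisymmetricOn (n + 2) H Ω ∧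
        (∀ y ∈ Ω, ConcaveOn ℝ Ω (fun x => H x y)) ∧
        (∀ x ∈ Ω, ConvexOn ℝ Ω (fun y => H x y)) ∧
        ∀ᵐ x ∂(CyclicMonotone.normalizedVolume Ω), HasGradientAt (fun y => H x y) (u x) x,
      (⨅ H ∈ CyclicMonotone.antisymmetricHamiltonians Ω (n + 2),
          CyclicMonotone.extIntegral (CyclicMonotone.normalizedVolume Ω)
            (fun x => CyclicMonotone.legendre Ω H x (Pi.single 0 (u x)))) =
        (⨆ S ∈ CyclicMonotone.measurePreservingInvolutions Ω (n + 2),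
          ((∫ x, inner ℝ (u x) (S x) ∂(CyclicMonotone.normalizedVolume Ω) : ℝ) : EReal)) ∧
        id ∈ CyclicMonotone.measurePreservingInvolutions Ω (n + 2) ∧
        IsMaxOn (fun S : CyclicMonotone.E d → CyclicMonotone.E d =>
            ∫ x, inner ℝ (u x) (S x) ∂(CyclicMonotone.normalizedVolume Ω))
          (CyclicMonotone.measurePreservingInvolutions Ω (n + 2)) id] := by
  obtain ⟨C, hC⟩ := hu_bdd
  obtain ⟨R, hR⟩ := hΩ_bounded.exists_norm_le
  have hpolar : ∀ Ω₀ : Set (CyclicMonotone.E d), volume Ω₀ = 0 →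
      CyclicMonotone.IsCyclicallyMonotoneOn (n + 2) u (Ω \ Ω₀) →
      ∀ π ∈ CyclicMonotone.symmetricPlans Ω (n + 2),
        0 ≤ ∫ x, inner ℝ (u (x 0)) (x 0 - x 1) ∂π := by
    intro Ω₀ h₀ hcyc π hπ
    have := CyclicMonotone.nonneg_integral_of_mem_symmetricPlans hΩ_open.measurableSet hu_meas hC
      hR h₀ hcyc hπ
    rwa [zero_add] at this
  have hplan : ∀ S ∈ CyclicMonotone.measurePreservingInvolutions Ω (n + 2), _ := fun S hS =>
    CyclicMonotone.map_orbit_mem_symmetricPlans hΩ_open hΩ_bounded hΩ_nonempty hS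
  have hcost : ∀ S ∈ CyclicMonotone.measurePreservingInvolutions Ω (n + 2), _ = _ := fun S hS =>
    CyclicMonotone.integral_map_orbit hΩ_open hΩ_bounded hΩ_nonempty hu_meas hC hR hS
  -- Statements 3 and 4 and the maximality clause of 6 all become the same inequality over `S`.
  rw [CyclicMonotone.isGLB_polar_iff,
    CyclicMonotone.isGLB_norm_sq_iff hΩ_open hΩ_bounded hΩ_nonempty hu_meas hC hR,
    CyclicMonotone.isMaxOn_iff hΩ_open hΩ_bounded hΩ_nonempty hu_meas hC hR]
  tfae_have 1 → 2 := by
    rintro ⟨Ω₀, h₀, hcyc⟩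
    have hid := CyclicMonotone.id_mem_measurePreservingInvolutions Ω (n + 2)
    have h1 := hplan id hid
    have h2 := hcost id hid
    simp only [id, sub_self, inner_zero_right, integral_zero] at h2
    rw [CyclicMonotone.orbit_id] at h1 h2
    refine ⟨IsLeast.isGLB ⟨⟨_, h1, h2⟩, ?_⟩, h1, h2⟩
    rintro _ ⟨π, hπ, rfl⟩
    exact hpolar Ω₀ h₀ hcyc π hπ
  tfae_have 2 → 3 := by
    rintro ⟨h, -, -⟩ S hS
    rw [← hcost S hS]
    exact h.1 ⟨_, hplan S hS, rfl⟩
  tfae_have 3 → 1 :=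
    CyclicMonotone.exists_isCyclicallyMonotoneOn_of_polar hΩ_open hΩ_bounded hΩ_nonempty hu_meas hC
  tfae_have 3 ↔ 4 := Iff.rfl
  tfae_have 1 → 5 := by
    rintro ⟨Ω₀, h₀, hcyc⟩
    obtain ⟨F, h1, h2, h3, h4, -⟩ := CyclicMonotone.exists_saddle_of_isCyclicallyMonotoneOn hΩ_open
      hΩ_convex hΩ_bounded hu_meas hC h₀ hcyc
    exact ⟨F, h1, h2, h3, h4⟩
  tfae_have 5 → 1 := by
    rintro ⟨F, h1, -, h3, h4⟩
    -- Finite volume makes the normalizing factor nonzero, so sets null for the normalized measure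
    -- are Lebesgue null within `Ω`.
    have hvol : (volume Ω)⁻¹ ≠ 0 := ENNReal.inv_ne_zero.2 hΩ_bounded.measure_lt_top.ne
    rw [CyclicMonotone.normalizedVolume_eq, Measure.ae_ennreal_smul_measure_iff hvol,
      ae_restrict_iff' hΩ_open.measurableSet] at h4
    refine ⟨_, h4, CyclicMonotone.isCyclicallyMonotoneOn_of_gradient h1 h3 Set.sdiff_subset ?_⟩
    exact fun x hx => Set.notMem_compl_iff.1 hx.2 hx.1
  tfae_have 6 → 3 := fun h => h.2.2
  tfae_have 1 → 6 := by
    rintro ⟨Ω₀, h₀, hcyc⟩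
    have hpol := tfae_2_to_3 (tfae_1_to_2 ⟨Ω₀, h₀, hcyc⟩)
    refine ⟨?_, CyclicMonotone.id_mem_measurePreservingInvolutions Ω _, hpol⟩
    rw [CyclicMonotone.iInf_extIntegral_legendre hΩ_open hΩ_convex hΩ_bounded hΩ_nonempty hu_meas
      hC hR h₀ hcyc, CyclicMonotone.iSup_integral_inner ((CyclicMonotone.isMaxOn_iff hΩ_open
      hΩ_bounded hΩ_nonempty hu_meas hC hR).2 hpol)]
  tfae_finish
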